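/- Let $(\bar p_k)_{k\ge0}$ be an offspring distribution with finite third moment, mean in $(1,\infty)$ and $\bar p_0>0$, and let $(a_y)_{y\in\mathbb Z}$ be a jump distribution with mean zero, finite variance, $a_0\neq1$, and $K(\theta):=\sum_{y\in\mathbb Z}a_y\theta^y<\infty$ for all $\theta\ge1$. Consider the discrete-time branching random walk on $\mathbb Z$ started from a single particle at the origin in which, in each generation, every particle first makes a jump with law $(a_y)$ and then produces at its new position a number of children with law $(\bar p_k)$, these children forming the next generation; all jumps and all offspring numbers are independent. Let $X(v)$ be the position at which the particle $v$ is born (so $X=0$ for the initial particle), let $\bar M=\sup_v X(v)\in[0,\infty]$, the supremum being over all particles of all generations, and let $\bar u(n)=P(\bar M\ge n)$. Let $q$ be the probability that some generation is empty, and let $\bar f(s)=\sum_k\bar p_ks^k$. Then the equation $K(s)=1/\bar f'(q)$ has exactly one solution $s=\bar\rho$ in $(1,\infty)$, and with $\bar\ell(n):=\bar\rho^{\,n}\bigl(\bar u(n)-(1-q)\bigr)$: (a) $0<\liminf_{n\to\infty}\bar\ell(n)\le\limsup_{n\to\infty}\bar\ell(n)\le q.$ (b) If moreover there is an integer $R>0$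 such that $a_k=0$ for all $k>R$ and $a_i>0$ for all $i=1,\dots,R$ (finite right range $R$ and nearly right-continuous), then there is $\kappa'\in(0,q]$ with $\lim_{n\to\infty}\bar\ell(n)=\kappa'$. -/

import Mathlib

open MeasureTheory ProbabilityTheory Filter Topology

noncomputable section

namespace BRW

/-! Particles are labelled by finite lists of natural numbers: `[]` is the initial particle and
`i :: v` is the `i`-th child of `v`, so `v.length` is the generation of `v`. The random input is a
number of offspring `N v` and a jump `ξ v` for each label `v`. A particle first jumps and then
reproduces, so the children of `v` are all born at the position of `v` plus the jump `ξ v`. -/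

/-- `InTree N v`: the label `v` belongs to the genealogical tree with offspring numbers `N`. -/
def InTree (N : List ℕ → ℕ) : List ℕ → Prop
  | [] => True
  | i :: v => InTree N v ∧ i < N v

/-- The position of the particle `v`, the initial particle being at the origin. -/
def position (ξ : List ℕ → ℤ) : List ℕ → ℤ
  | [] => 0
  | _ :: v => position ξ v + ξ v

/-- The number of particles in generation `n`. -/
def generationSize (N : List ℕ → ℕ) (n : ℕ) : ℕ∞ :=
  Set.encard {v : List ℕ | InTree N v ∧ v.length = n}

/-- The maximal displacement up to generation `n`. -/
def maxUpTo (N : List ℕ → ℕ) (ξ : List ℕ → ℤ) (n : ℕ) : EReal :=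
  ⨆ v ∈ {v : List ℕ | InTree N v ∧ v.length ≤ n}, (((position ξ v : ℤ) : ℝ) : EReal)

/-- The maximal displacement over all generations, possibly `⊤`. -/
def maxDisplacement (N : List ℕ → ℕ) (ξ : List ℕ → ℤ) : EReal :=
  ⨆ n : ℕ, maxUpTo N ξ n

/-- Offspring numbers `N` and jumps `ξ` that drive a branching random walk with offspring
distribution `p` and jump distribution `a`: all the variables `N v`, `ξ v` are independent
(the pairs are independent over `v`, and so are the two entries of each pair),
each `N v` has law `p` and each `ξ v` has law `a`. -/
structure IsBranchingRandomWalk {Ω : Type*} [MeasurableSpace Ω] (P : Measure Ω)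
    (p : PMF ℕ) (a : PMF ℤ) (N : List ℕ → Ω → ℕ) (ξ : List ℕ → Ω → ℤ) : Prop where
  measurable_offspring : ∀ v, Measurable (N v)
  measurable_jump : ∀ v, Measurable (ξ v)
  indep_particles : iIndepFun (fun v ω => (ξ v ω, N v ω)) P
  indep_jump_offspring : ∀ v, IndepFun (ξ v) (N v) P
  law_offspring : ∀ v, P.map (N v) = p.toMeasure
  law_jump : ∀ v, P.map (ξ v) = a.toMeasure

/-- The probability of extinction. -/
def extinctionProb {Ω : Type*} [MeasurableSpace Ω] (P : Measure Ω) (N : List ℕ → Ω → ℕ) : ℝ :=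
  P.real {ω | ∃ n : ℕ, 1 ≤ n ∧ generationSize (fun v => N v ω) n = 0}

/-- The probability that the maximal displacement over all generations is at least `n`. -/
def tailProb {Ω : Type*} [MeasurableSpace Ω] (P : Measure Ω)
    (N : List ℕ → Ω → ℕ) (ξ : List ℕ → Ω → ℤ) (n : ℤ) : ℝ :=
  P.real {ω | ((n : ℝ) : EReal) ≤ maxDisplacement (fun v => N v ω) (fun v => ξ v ω)}

/-- The probability generating function of the offspring distribution. -/
def offspringPGF (p : PMF ℕ) (s : ℝ) : ℝ := ∑' k : ℕ, (p k).toReal * s ^ k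

/-- The probability generating function `K` of the jump distribution. -/
def jumpPGF (a : PMF ℤ) (θ : ℝ) : ℝ := ∑' y : ℤ, (a y).toReal * θ ^ y

/-- A solution `s ∈ (1, ∞)` of `K s = γ`; to be used where it exists and is unique. -/
def rho (a : PMF ℤ) (γ : ℝ) : ℝ :=
  Classical.epsilon fun s : ℝ => 1 < s ∧ jumpPGF a s = γ

/-- The jump distribution has finite right range `R`. -/
def HasRightRange (a : PMF ℤ) (R : ℕ) : Prop :=
  0 < R ∧ 0 < a (R : ℤ) ∧ ∀ k : ℤ, (R : ℤ) < k → a k = 0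

/-- The jump distribution, of finite right range `R`, is nearly right-continuous. -/
def NearlyRightContinuous (a : PMF ℤ) (R : ℕ) : Prop :=
  ∀ i : ℤ, 1 ≤ i → i ≤ (R : ℤ) → 0 < a i

end BRW

end

/-! Conditioning on the first particle gives `u n = 1 - ∑ a_y f(1 - u (n - y))` for `n > 0`, with `u
= 1` for `n ≤ 0`. Centring at the fixed point `q` of `f`, `w = u - (1 - q)` solves `w n = ∑ a_y g (w
(n - y))`, where `g s = q - f (q - s)` has slope `m = f'(q) < 1` at the origin. The linearised
recursion is solved by `ρ ^ (-n)` exactly when `m * K ρ = 1`, whence the rate.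

Upper bound: `f` lies above its tangent at `q`, so `q * ρ ^ (-n)` dominates the recursion; induction
over truncated generations and a limit give `w n ≤ q * ρ ^ (-n)` (`reachProb_sub_le`). That `w ≥ 0`
is `survival_le_of_recursion`: the limit of `u` at infinity is a fixed point, and supercritical
growth near zero excludes the limit `0`.

Lower bound: `c * (ρ ^ (-n) + ρ ^ (-2n))`, cut off to zero at negative `n`, is a subsolution far
out. Since `m * K (ρ ^ 2) > 1`, its second term pays for the quadratic error and for the cut
(`exists_lower_bound`).

Convergence: `h n = ρ ^ n * w n` is subharmonic on `n > 0` for the tilted walk `b y = m * a y * ρ ^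
y`, which has positive drift, and the defect vanishes at infinity. A flux argument,
`exists_tendsto_of_subharmonic`, identifies limsup and liminf. -/

namespace BRW

/-! ### Law of the environment and branching at the root -/

/-- A realisation of all jumps and offspring numbers. -/
abbrev Env : Type := List ℕ → ℤ × ℕ

/-- The joint law of the jump and the offspring number of one particle. -/
noncomputable abbrev particleLaw (p : PMF ℕ) (a : PMF ℤ) : Measure (ℤ × ℕ) :=
  a.toMeasure.prod p.toMeasure

/-- The law of the environment. -/
noncomputable abbrev envLaw (p : PMF ℕ) (a : PMF ℤ) : Measure Env :=
  Measure.infinitePi fun _ => particleLaw p a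

/-- The environment seen from the `i`-th child of the initial particle. -/
def shift (i : ℕ) (x : Env) : Env := fun v => x (v ++ [i])

lemma measurable_shift (i : ℕ) : Measurable (shift i) := by
  unfold shift; fun_prop

lemma IsBranchingRandomWalk.map_env {Ω : Type*} [MeasurableSpace Ω] {P : Measure Ω}
    [IsProbabilityMeasure P] {p : PMF ℕ} {a : PMF ℤ} {N : List ℕ → Ω → ℕ} {ξ : List ℕ → Ω → ℤ}
    (hX : IsBranchingRandomWalk P p a N ξ) :
    P.map (fun ω v => (ξ v ω, N v ω)) = envLaw p a := by
  rw [hX.indep_particles.map_fun_eq_infinitePi_map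
    (fun v => (hX.measurable_jump v).prodMk (hX.measurable_offspring v))]
  congr 1
  funext v
  rw [(indepFun_iff_map_prod_eq_prod_map_map (hX.measurable_jump v).aemeasurable
    (hX.measurable_offspring v).aemeasurable).1 (hX.indep_jump_offspring v),
    hX.law_offspring, hX.law_jump]

/-- Splits a label into the child of the root it descends from and the label relative to it. -/
def splitRoot (v : List ℕ) : Option ℕ × List ℕ := (v.getLast?, v.dropLast)

lemma splitRoot_injective : Function.Injective splitRoot := by
  intro v w h
  simp only [splitRoot, Prod.mk.injEq] at h
  rcases List.eq_nil_or_concat' v with rfl | ⟨v, i, rfl⟩ <;>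
  rcases List.eq_nil_or_concat' w with rfl | ⟨w, j, rfl⟩ <;> simp_all

/-- Glues a root and the environments of its children together. -/
def glue (z : Option ℕ → Env) : Env := fun v => z (splitRoot v).1 (splitRoot v).2

lemma measurable_glue : Measurable glue := by
  unfold glue; fun_prop

/-- `splitRoot` embeds the labels into pairs (child or root, relative label), so gluing only selects
coordinates of a product measure. Of the environment at `none`, only the root coordinate is kept. -/
lemma map_glue (p : PMF ℕ) (a : PMF ℤ) :
    (Measure.infinitePi fun _ : Option ℕ => envLaw p a).map glue = envLaw p a := by
  have h1 := Measure.map_infinitePi_infinitePi_of_inj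
    (P := fun _ : Option ℕ × List ℕ => particleLaw p a) splitRoot_injective
  have h2 := Measure.infinitePi_map_curry_symm
    (fun (_ : Option ℕ) (_ : List ℕ) => particleLaw p a)
  rw [← h2, Measure.map_map (by fun_prop) (by fun_prop)] at h1
  exact h1

/-- The branching property at the root. -/
lemma envLaw_branching (p : PMF ℕ) (a : PMF ℤ) (B : ℤ → Set Env)
    (hB : ∀ y, MeasurableSet (B y)) :
    envLaw p a {x | ∀ i < (x []).2, shift i x ∈ B (x []).1} =
      ∑' y : ℤ, a y * ∑' k : ℕ, p k * envLaw p a (B y) ^ k := by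
  set μ := envLaw p a with hμ
  have hS : {x : Env | ∀ i < (x []).2, shift i x ∈ B (x []).1} =
      ⋃ yk : ℤ × ℕ, {x : Env | x [] = yk ∧ ∀ i < yk.2, shift i x ∈ B yk.1} := by
    ext x; simp
  have hmeas : ∀ yk : ℤ × ℕ,
      MeasurableSet {x : Env | x [] = yk ∧ ∀ i < yk.2, shift i x ∈ B yk.1} := by
    intro yk
    have : {x : Env | x [] = yk ∧ ∀ i < yk.2, shift i x ∈ B yk.1} =
        ((fun x : Env => x []) ⁻¹' {yk}) ∩ ⋂ i, ⋂ (_ : i < yk.2), shift i ⁻¹' (B yk.1) := by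
      ext x; simp
    rw [this]
    exact ((measurable_pi_apply _) (measurableSet_singleton _)).inter
      (.iInter fun i => .iInter fun _ => measurable_shift i (hB _))
  have key : ∀ yk : ℤ × ℕ,
      μ {x : Env | x [] = yk ∧ ∀ i < yk.2, shift i x ∈ B yk.1} =
        a yk.1 * p yk.2 * μ (B yk.1) ^ yk.2 := by
    intro yk
    rw [hμ, ← map_glue p a, Measure.map_apply measurable_glue (hmeas yk)]
    -- The event is a finite cylinder: `none` carries the root data, `some i` with `i < yk.2` the
    -- subtree of child `i`.
    let t : Option ℕ → Set Env := fun o => o.elim ((fun x : Env => x []) ⁻¹' {yk}) fun _ => B yk.1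
    have ht : ∀ o, MeasurableSet (t o) := by
      intro o
      cases o with
      | none => exact (measurable_pi_apply _) (measurableSet_singleton _)
      | some i => exact hB _
    have hset : glue ⁻¹' {x : Env | x [] = yk ∧ ∀ i < yk.2, shift i x ∈ B yk.1} =
        Set.pi (Finset.insertNone (Finset.range yk.2) : Finset (Option ℕ)) t := by
      ext z
      have hsh : ∀ i, shift i (glue z) = z (some i) := by
        intro i; funext v; simp [shift, glue, splitRoot]
      have h0 : glue z [] = z none [] := by simp [glue, splitRoot]
      simp only [Set.mem_preimage, Set.mem_ofPred_eq, hsh, h0, Set.mem_pi, Finset.mem_coe]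
      constructor
      · rintro ⟨h1, h2⟩ o ho
        cases o with
        | none => exact h1
        | some i => exact h2 i (by simpa using ho)
      · intro h
        exact ⟨h none (by simp), fun i hi => h (some i) (by simpa using hi)⟩
    rw [hset, Measure.infinitePi_pi _ (fun i _ => ht i), Finset.prod_insertNone]
    have h1 : envLaw p a (t none) = a yk.1 * p yk.2 := by
      change envLaw p a ((fun x : Env => x []) ⁻¹' {yk}) = _
      rw [← Measure.map_apply (measurable_pi_apply _) (measurableSet_singleton _),
        Measure.infinitePi_map_eval (fun _ : List ℕ => particleLaw p a) [],
        show ({yk} : Set (ℤ × ℕ)) = {yk.1} ×ˢ {yk.2} by simp, Measure.prod_prod]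
      simp [PMF.toMeasure_apply_singleton]
    rw [h1]
    simp only [t, Option.elim, Finset.prod_const, Finset.card_range]
    rw [map_glue]
  rw [hS, measure_iUnion _ hmeas, ENNReal.tsum_prod']
  · simp_rw [key, ← ENNReal.tsum_mul_left, mul_assoc]
  · intro i j hij
    refine Set.disjoint_left.2 fun x hx hx' => hij (hx.1.symm.trans hx'.1)

lemma tsum_mul_pow_le_one (p : PMF ℕ) {s : ENNReal} (hs : s ≤ 1) : ∑' k, p k * s ^ k ≤ 1 := by
  rw [← p.tsum_coe]
  exact ENNReal.tsum_le_tsum fun k => mul_le_of_le_one_right' (pow_le_one' hs k)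

lemma toReal_tsum_mul_pow (p : PMF ℕ) (s : ENNReal) (hs : s ≤ 1) :
    (∑' k, p k * s ^ k).toReal = offspringPGF p s.toReal := by
  rw [ENNReal.tsum_toReal_eq]
  · simp [offspringPGF]
  · intro k
    exact ENNReal.mul_ne_top (p.apply_ne_top k)
      (ENNReal.pow_ne_top (ne_top_of_le_ne_top ENNReal.one_ne_top hs))

lemma envLaw_real_branching (p : PMF ℕ) (a : PMF ℤ) (B : ℤ → Set Env)
    (hB : ∀ y, MeasurableSet (B y)) :
    (envLaw p a).real {x | ∀ i < (x []).2, shift i x ∈ B (x []).1} =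
      ∑' y : ℤ, (a y).toReal * offspringPGF p ((envLaw p a).real (B y)) := by
  rw [Measure.real, envLaw_branching p a B hB, ENNReal.tsum_toReal_eq]
  · refine tsum_congr fun y => ?_
    rw [ENNReal.toReal_mul, toReal_tsum_mul_pow _ _ prob_le_one, Measure.real]
  · intro y
    exact ENNReal.mul_ne_top (a.apply_ne_top y)
      (ne_top_of_le_ne_top ENNReal.one_ne_top (tsum_mul_pow_le_one p prob_le_one))

/-! ### Decomposition of the tree and of its events at the root -/

lemma inTree_append_singleton (N : List ℕ → ℕ) (i : ℕ) (v : List ℕ) :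
    InTree N (v ++ [i]) ↔ i < N [] ∧ InTree (fun u => N (u ++ [i])) v := by
  induction v with
  | nil => simp [InTree]
  | cons j v ih => simp only [List.cons_append, InTree, ih]; tauto

lemma position_append_singleton (ξ : List ℕ → ℤ) (i : ℕ) (v : List ℕ) :
    position ξ (v ++ [i]) = ξ [] + position (fun u => ξ (u ++ [i])) v := by
  induction v with
  | nil => simp [position]
  | cons j v ih => simp only [List.cons_append, position, ih]; ring

lemma forall_inTree_iff (N : List ℕ → ℕ) (Q : List ℕ → Prop) :
    (∀ v, InTree N v → Q v) ↔
      Q [] ∧ ∀ i < N [], ∀ v, InTree (fun u => N (u ++ [i])) v → Q (v ++ [i]) := by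
  constructor
  · intro h
    exact ⟨h [] trivial, fun i hi v hv => h _ ((inTree_append_singleton N i v).2 ⟨hi, hv⟩)⟩
  · rintro ⟨h0, h⟩ v hv
    rcases List.eq_nil_or_concat' v with rfl | ⟨v, i, rfl⟩
    · exact h0
    · obtain ⟨hi, hv⟩ := (inTree_append_singleton N i v).1 hv
      exact h i hi v hv

/-- All particles whose generation satisfies `D` are born below `n`. -/
def allBelow (D : ℕ → Prop) (n : ℤ) : Set Env :=
  {x | ∀ v, InTree (fun v => (x v).2) v → D v.length → position (fun v => (x v).1) v < n}

/-- Generation `k` is empty. -/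
def emptyGeneration (k : ℕ) : Set Env :=
  {x | ∀ v, InTree (fun v => (x v).2) v → v.length ≠ k}

lemma measurableSet_inTree (v : List ℕ) :
    MeasurableSet {x : Env | InTree (fun v => (x v).2) v} := by
  induction v with
  | nil => simp [InTree]
  | cons i v ih =>
    refine ih.inter (?_ : MeasurableSet {x : Env | i < (x v).2})
    exact measurableSet_lt measurable_const (measurable_pi_apply v).snd

lemma measurable_position (v : List ℕ) :
    Measurable fun x : Env => position (fun v => (x v).1) v := by
  induction v with
  | nil => exact measurable_const
  | cons i v ih => exact ih.add (measurable_pi_apply v).fst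

lemma measurableSet_allBelow (D : ℕ → Prop) (n : ℤ) : MeasurableSet (allBelow D n) := by
  have : allBelow D n = ⋂ v : List ℕ, ({x : Env | InTree (fun v => (x v).2) v}ᶜ ∪
      ({x | D v.length → position (fun v => (x v).1) v < n})) := by
    ext x
    simp only [allBelow, Set.mem_ofPred_eq, Set.mem_iInter, Set.mem_union, Set.mem_compl_iff]
    exact forall_congr' fun v => imp_iff_not_or
  rw [this]
  refine .iInter fun v => (measurableSet_inTree v).compl.union ?_
  by_cases h : D v.length
  · simpa [h] using measurableSet_lt (measurable_position v) measurable_const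
  · simp [h]

lemma measurableSet_emptyGeneration (k : ℕ) : MeasurableSet (emptyGeneration k) := by
  have : emptyGeneration k = ⋂ v : List ℕ, ({x : Env | InTree (fun v => (x v).2) v}ᶜ ∪
      ({_x | v.length ≠ k})) := by
    ext x
    simp only [emptyGeneration, Set.mem_ofPred_eq, Set.mem_iInter, Set.mem_union,
      Set.mem_compl_iff]
    exact forall_congr' fun v => imp_iff_not_or
  rw [this]
  exact .iInter fun v => (measurableSet_inTree v).compl.union (.const _)

/-- The root sits at the origin, so `0 < n` makes its own constraint void. Seen from a child, the
barrier moves by the jump of the root and generations are counted one later. -/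
lemma allBelow_eq_branching (D : ℕ → Prop) {n : ℤ} (hn : 0 < n) :
    allBelow D n =
      {x | ∀ i < (x []).2, shift i x ∈ allBelow (fun l => D (l + 1)) (n - (x []).1)} := by
  ext x
  simp only [allBelow, Set.mem_ofPred_eq]
  rw [forall_inTree_iff]
  have : D ([] : List ℕ).length → position (fun v => (x v).1) [] < n := fun _ => hn
  simp only [position_append_singleton, List.length_append, List.length_singleton, shift,
    lt_sub_iff_add_lt']
  exact and_iff_right this

lemma emptyGeneration_succ (k : ℕ) :
    emptyGeneration (k + 1) = {x | ∀ i < (x []).2, shift i x ∈ emptyGeneration k} := by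
  ext x
  simp only [emptyGeneration, Set.mem_ofPred_eq]
  rw [forall_inTree_iff]
  simp [shift]

/-- The probability that some particle whose generation satisfies `D` is born at or above `n`. -/
noncomputable def reachProb (p : PMF ℕ) (a : PMF ℤ) (D : ℕ → Prop) (n : ℤ) : ℝ :=
  1 - (envLaw p a).real (allBelow D n)

/-! ### Probability of reaching a level, and its recursion -/

section reachProb

variable (p : PMF ℕ) (a : PMF ℤ) (D : ℕ → Prop)

lemma reachProb_nonneg (n : ℤ) : 0 ≤ reachProb p a D n :=
  sub_nonneg.2 measureReal_le_one

lemma reachProb_le_one (n : ℤ) : reachProb p a D n ≤ 1 :=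
  sub_le_self _ measureReal_nonneg

lemma reachProb_antitone : Antitone (reachProb p a D) := fun _ _ hnm =>
  sub_le_sub_left (measureReal_mono fun _ hx v hv hl => (hx v hv hl).trans_le hnm) _

lemma reachProb_of_nonpos (h0 : D 0) {n : ℤ} (hn : n ≤ 0) : reachProb p a D n = 1 := by
  have : allBelow D n = ∅ := by
    refine Set.eq_empty_of_forall_notMem fun x hx => ?_
    exact absurd (hx [] trivial h0) (by simpa [position] using hn)
  simp [reachProb, this]

lemma reachProb_zero_generations {n : ℤ} (hn : 0 < n) : reachProb p a (· ≤ 0) n = 0 := by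
  have : allBelow (· ≤ 0) n = Set.univ := by
    refine Set.eq_univ_of_forall fun x v _ hl => ?_
    obtain rfl : v = [] := by simpa using hl
    simpa [position] using hn
  rw [reachProb, this, probReal_univ, sub_self]

lemma reachProb_eq_branching {n : ℤ} (hn : 0 < n) :
    reachProb p a D n =
      1 - ∑' y : ℤ, (a y).toReal *
        offspringPGF p (1 - reachProb p a (fun l => D (l + 1)) (n - y)) := by
  rw [reachProb, allBelow_eq_branching D hn,
    envLaw_real_branching p a (fun y => allBelow (fun l => D (l + 1)) (n - y))
      (fun y => measurableSet_allBelow _ _)]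
  simp [reachProb]

lemma tendsto_reachProb (n : ℤ) :
    Tendsto (fun k : ℕ => reachProb p a (· ≤ k) n) atTop
      (𝓝 (reachProb p a (fun _ => True) n)) := by
  have hI : allBelow (fun _ => True) n = ⋂ k : ℕ, allBelow (· ≤ k) n := by
    ext x
    simp only [allBelow, Set.mem_ofPred_eq, Set.mem_iInter]
    exact ⟨fun h k v hv _ => h v hv trivial, fun h v hv _ => h v.length v hv le_rfl⟩
  have hanti : Antitone fun k : ℕ => allBelow (· ≤ k) n :=
    fun k l hkl x hx v hv hl => hx v hv (hl.trans hkl)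
  refine Tendsto.const_sub 1 ?_
  rw [hI]
  exact (ENNReal.tendsto_toReal (measure_ne_top _ _)).comp
    (tendsto_measure_iInter_atTop
      (fun k => (measurableSet_allBelow _ _).nullMeasurableSet) hanti ⟨0, measure_ne_top _ _⟩)

end reachProb

/-! ### From the given walk to the product space -/

lemma intCast_le_maxDisplacement_iff (N : List ℕ → ℕ) (ξ : List ℕ → ℤ) (n : ℤ) :
    ((n : ℝ) : EReal) ≤ maxDisplacement N ξ ↔ ∃ v, InTree N v ∧ n ≤ position ξ v := by
  constructor
  · intro h
    by_contra! hlt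
    -- Integrality is essential: it turns strict bounds on all positions into a strict bound on the
    -- supremum.
    have hle : maxDisplacement N ξ ≤ (((n - 1 : ℤ) : ℝ) : EReal) := by
      refine iSup_le fun k => iSup₂_le fun v hv => ?_
      exact EReal.coe_le_coe_iff.2 (Int.cast_le.2 (Int.le_sub_one_of_lt (hlt v hv.1)))
    have := EReal.coe_le_coe_iff.1 (h.trans hle)
    rw [Int.cast_le] at this
    omega
  · rintro ⟨v, hv, hn⟩
    refine le_trans (EReal.coe_le_coe_iff.2 (Int.cast_le.2 hn)) ?_
    refine le_trans ?_ (le_iSup (fun k => maxUpTo N ξ k) v.length)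
    exact le_iSup₂ (f := fun (v : List ℕ) (_ : v ∈ {v : List ℕ | InTree N v ∧ v.length ≤ _}) =>
      (((position ξ v : ℤ) : ℝ) : EReal)) v ⟨hv, le_rfl⟩

section law

variable {Ω : Type*} [MeasurableSpace Ω] {P : Measure Ω}
  {p : PMF ℕ} {a : PMF ℤ} {N : List ℕ → Ω → ℕ} {ξ : List ℕ → Ω → ℤ}

lemma IsBranchingRandomWalk.measurable_env (hX : IsBranchingRandomWalk P p a N ξ) :
    Measurable (fun ω v => (ξ v ω, N v ω) : Ω → Env) :=
  measurable_pi_iff.2 fun v => (hX.measurable_jump v).prodMk (hX.measurable_offspring v)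

lemma IsBranchingRandomWalk.tailProb_eq [IsProbabilityMeasure P]
    (hX : IsBranchingRandomWalk P p a N ξ) (n : ℤ) :
    tailProb P N ξ n = reachProb p a (fun _ => True) n := by
  have h : {ω | ((n : ℝ) : EReal) ≤ maxDisplacement (fun v => N v ω) (fun v => ξ v ω)} =
      (fun ω v => (ξ v ω, N v ω) : Ω → Env) ⁻¹' (allBelow (fun _ => True) n)ᶜ := by
    ext ω
    simp [intCast_le_maxDisplacement_iff, allBelow]
  rw [tailProb, h, reachProb, ← probReal_compl_eq_one_sub (measurableSet_allBelow _ _),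
    ← hX.map_env, map_measureReal_apply hX.measurable_env (measurableSet_allBelow _ _).compl]

/-- The probability that generation `k` is empty. -/
noncomputable def emptyProb (p : PMF ℕ) (a : PMF ℤ) (k : ℕ) : ℝ :=
  (envLaw p a).real (emptyGeneration k)

lemma emptyProb_zero (p : PMF ℕ) (a : PMF ℤ) : emptyProb p a 0 = 0 := by
  have : emptyGeneration 0 = ∅ :=
    Set.eq_empty_of_forall_notMem fun x hx => hx [] trivial rfl
  simp [emptyProb, this]

/-- The branching property with an event not depending on the jump: the jump law sums to one and
drops out. -/
lemma emptyProb_succ (p : PMF ℕ) (a : PMF ℤ) (k : ℕ) :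
    emptyProb p a (k + 1) = offspringPGF p (emptyProb p a k) := by
  rw [emptyProb, emptyGeneration_succ, envLaw_real_branching p a (fun _ => emptyGeneration k)
    (fun _ => measurableSet_emptyGeneration k), tsum_mul_right, ← ENNReal.tsum_toReal_eq
    (fun y => a.apply_ne_top y), a.tsum_coe]
  simp [emptyProb]

lemma emptyGeneration_mono : Monotone emptyGeneration := by
  refine monotone_nat_of_le_succ fun k x hx v hv hl => ?_
  cases v with
  | nil => simp at hl
  | cons i v => exact hx v hv.1 (by simpa using hl)

lemma IsBranchingRandomWalk.tendsto_emptyProb [IsProbabilityMeasure P]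
    (hX : IsBranchingRandomWalk P p a N ξ) :
    Tendsto (emptyProb p a) atTop (𝓝 (extinctionProb P N)) := by
  have h : {ω | ∃ n : ℕ, 1 ≤ n ∧ generationSize (fun v => N v ω) n = 0} =
      (fun ω v => (ξ v ω, N v ω) : Ω → Env) ⁻¹' (⋃ k, emptyGeneration k) := by
    ext ω
    simp only [generationSize, Set.encard_eq_zero, Set.eq_empty_iff_forall_notMem,
      Set.mem_ofPred_eq, Set.mem_preimage, Set.mem_iUnion, emptyGeneration, not_and]
    constructor
    · rintro ⟨n, -, hn⟩
      exact ⟨n, hn⟩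
    · rintro ⟨n, hn⟩
      refine ⟨n, Nat.one_le_iff_ne_zero.2 ?_, hn⟩
      rintro rfl
      exact hn [] trivial rfl
  rw [extinctionProb, h, ← map_measureReal_apply hX.measurable_env
    (.iUnion measurableSet_emptyGeneration), hX.map_env]
  exact (ENNReal.tendsto_toReal (measure_ne_top _ _)).comp
    (tendsto_measure_iUnion_atTop emptyGeneration_mono)

end law

/-! ### Convexity bounds for the offspring generating function -/

lemma tangent_le_pow {s t : ℝ} (hs : 0 ≤ s) (ht : 0 ≤ t) (k : ℕ) :
    t ^ k + k * t ^ (k - 1) * (s - t) ≤ s ^ k := by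
  induction k with
  | zero => simp
  | succ k ih =>
    have h1 := mul_le_mul_of_nonneg_left ih hs
    have h2 : (k : ℝ) * t ^ (k - 1) * t = k * t ^ k := by
      cases k with
      | zero => simp
      | succ k => simp [pow_succ]; ring
    have h3 : 0 ≤ (k : ℝ) * t ^ (k - 1) * (s - t) ^ 2 := by positivity
    have h4 : s * (t ^ k + k * t ^ (k - 1) * (s - t)) =
        t ^ (k + 1) + (k * t ^ (k - 1) * t + t ^ k) * (s - t) +
          k * t ^ (k - 1) * (s - t) ^ 2 := by ring
    rw [h4, h2] at h1
    rw [pow_succ' s, Nat.add_sub_cancel]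
    push_cast
    linarith [h1]

/-- Multiplying the bound for `k` by `s` adds at most `k * (s - t) ^ 2` to the error, and `k ^ 2 + k
≤ (k + 1) ^ 2`. Summed against `p`, the coefficient becomes the second moment. -/
lemma pow_le_tangent_add_sq {s t : ℝ} (hs : 0 ≤ s) (hs1 : s ≤ 1) (ht : 0 ≤ t) (ht1 : t ≤ 1)
    (k : ℕ) :
    s ^ k ≤ t ^ k + k * t ^ (k - 1) * (s - t) + (k : ℝ) ^ 2 * (s - t) ^ 2 := by
  induction k with
  | zero => simp
  | succ k ih =>
    have h1 := mul_le_mul_of_nonneg_left ih hs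
    have h2 : (k : ℝ) * t ^ (k - 1) * t = k * t ^ k := by
      cases k with
      | zero => simp
      | succ k => simp [pow_succ]; ring
    have h3 : (k : ℝ) * t ^ (k - 1) * (s - t) ^ 2 ≤ k * (s - t) ^ 2 :=
      mul_le_mul_of_nonneg_right
        (mul_le_of_le_one_right (Nat.cast_nonneg k) (pow_le_one₀ ht ht1)) (sq_nonneg _)
    have h5 : s * ((k : ℝ) ^ 2 * (s - t) ^ 2) ≤ (k : ℝ) ^ 2 * (s - t) ^ 2 :=
      mul_le_of_le_one_left (by positivity) hs1
    have h6 : 0 ≤ ((k : ℝ) + 1) * (s - t) ^ 2 := by positivity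
    have h4 : s * (t ^ k + k * t ^ (k - 1) * (s - t) + (k : ℝ) ^ 2 * (s - t) ^ 2) =
        t ^ (k + 1) + (k * t ^ (k - 1) * t + t ^ k) * (s - t) +
          k * t ^ (k - 1) * (s - t) ^ 2 + s * ((k : ℝ) ^ 2 * (s - t) ^ 2) := by ring
    rw [h4, h2] at h1
    rw [pow_succ' s, Nat.add_sub_cancel]
    push_cast
    nlinarith [h1, h3, h5, h6]

lemma hasSum_toReal {α : Type*} (p : PMF α) : HasSum (fun k => (p k).toReal) 1 := by
  have h := ENNReal.hasSum_toReal (f := p) p.tsum_coe_ne_top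
  rwa [← ENNReal.tsum_toReal_eq p.apply_ne_top, p.tsum_coe, ENNReal.toReal_one] at h

lemma toReal_le_one {α : Type*} (p : PMF α) (k : α) : (p k).toReal ≤ 1 :=
  ENNReal.toReal_le_of_le_ofReal zero_le_one (by simpa using p.coe_le_one k)

/-- The termwise derivative of the probability generating function. -/
noncomputable def offspringPGFDeriv (p : PMF ℕ) (s : ℝ) : ℝ :=
  ∑' k : ℕ, (p k).toReal * (k * s ^ (k - 1))

section pgf

variable {p : PMF ℕ}

lemma summable_pgf {s : ℝ} (hs : 0 ≤ s) (hs1 : s ≤ 1) :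
    Summable fun k : ℕ => (p k).toReal * s ^ k :=
  (hasSum_toReal p).summable.of_nonneg_of_le (fun k => by positivity)
    fun k => mul_le_of_le_one_right ENNReal.toReal_nonneg (pow_le_one₀ hs hs1)

lemma offspringPGF_one : offspringPGF p 1 = 1 := by
  simp [offspringPGF, (hasSum_toReal p).tsum_eq]

lemma offspringPGF_mono {s t : ℝ} (hs : 0 ≤ s) (hst : s ≤ t) (ht : t ≤ 1) :
    offspringPGF p s ≤ offspringPGF p t :=
  (summable_pgf hs (hst.trans ht)).tsum_le_tsum
    (fun k => by gcongr) (summable_pgf (hs.trans hst) ht)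

lemma offspringPGF_nonneg {s : ℝ} (hs : 0 ≤ s) : 0 ≤ offspringPGF p s :=
  tsum_nonneg fun k => by positivity

lemma offspringPGF_le_one {s : ℝ} (hs : 0 ≤ s) (hs1 : s ≤ 1) : offspringPGF p s ≤ 1 :=
  (offspringPGF_mono hs hs1 le_rfl).trans_eq offspringPGF_one

variable (h2 : Summable fun k : ℕ => (p k).toReal * (k : ℝ) ^ 2)
include h2

lemma summable_mean : Summable fun k : ℕ => (p k).toReal * (k : ℝ) :=
  h2.of_nonneg_of_le (fun k => by positivity) fun k => by
    gcongr
    exact_mod_cast Nat.le_self_pow two_ne_zero k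

lemma summable_pgfDeriv {s : ℝ} (hs : 0 ≤ s) (hs1 : s ≤ 1) :
    Summable fun k : ℕ => (p k).toReal * (k * s ^ (k - 1)) :=
  (summable_mean h2).of_nonneg_of_le (fun k => by positivity) fun k => by
    gcongr
    exact mul_le_of_le_one_right (Nat.cast_nonneg k) (pow_le_one₀ hs hs1)

lemma tangent_le_offspringPGF {s t : ℝ} (hs : 0 ≤ s) (hs1 : s ≤ 1) (ht : 0 ≤ t) (ht1 : t ≤ 1) :
    offspringPGF p t + offspringPGFDeriv p t * (s - t) ≤ offspringPGF p s := by
  have hD := (summable_pgfDeriv h2 ht ht1).mul_right (s - t)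
  rw [offspringPGFDeriv, ← tsum_mul_right, offspringPGF, ← (summable_pgf ht ht1).tsum_add hD]
  refine ((summable_pgf ht ht1).add hD).tsum_le_tsum (fun k => ?_) (summable_pgf hs hs1)
  rw [mul_assoc, ← mul_add]
  exact mul_le_mul_of_nonneg_left (tangent_le_pow hs ht k) ENNReal.toReal_nonneg

lemma offspringPGF_le_tangent_add_sq {s t : ℝ} (hs : 0 ≤ s) (hs1 : s ≤ 1) (ht : 0 ≤ t)
    (ht1 : t ≤ 1) :
    offspringPGF p s ≤ offspringPGF p t + offspringPGFDeriv p t * (s - t) +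
      (∑' k : ℕ, (p k).toReal * (k : ℝ) ^ 2) * (s - t) ^ 2 := by
  have hD := (summable_pgfDeriv h2 ht ht1).mul_right (s - t)
  have hQ := h2.mul_right ((s - t) ^ 2)
  rw [offspringPGFDeriv, ← tsum_mul_right, ← tsum_mul_right, offspringPGF, offspringPGF,
    ← (summable_pgf ht ht1).tsum_add hD, ← ((summable_pgf ht ht1).add hD).tsum_add hQ]
  refine (summable_pgf hs hs1).tsum_le_tsum (fun k => ?_) (((summable_pgf ht ht1).add hD).add hQ)
  refine (mul_le_mul_of_nonneg_left (pow_le_tangent_add_sq hs hs1 ht ht1 k)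
    ENNReal.toReal_nonneg).trans_eq ?_
  ring

/-- The tangent at `t` bounds the increment, and slopes increase up to `r`. With `r = q` this makes
the recursion a contraction. -/
lemma offspringPGF_sub_le {s t r : ℝ} (hs : 0 ≤ s) (hst : s ≤ t) (htr : t ≤ r) (hr : r ≤ 1) :
    offspringPGF p t - offspringPGF p s ≤ offspringPGFDeriv p r * (t - s) := by
  have ht : 0 ≤ t := hs.trans hst
  have h1 := tangent_le_offspringPGF h2 hs (hst.trans (htr.trans hr)) ht (htr.trans hr)
  have h3 : offspringPGFDeriv p t ≤ offspringPGFDeriv p r :=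
    (summable_pgfDeriv h2 ht (htr.trans hr)).tsum_le_tsum (fun k => by gcongr)
      (summable_pgfDeriv h2 (ht.trans htr) hr)
  nlinarith [mul_le_mul_of_nonneg_right h3 (sub_nonneg.2 hst)]

/-- The tangent and quadratic bounds trap the remainder between `0` and a multiple of `(s - t) ^ 2`.
-/
lemma hasDerivAt_offspringPGF {t : ℝ} (ht : 0 < t) (ht1 : t < 1) :
    HasDerivAt (offspringPGF p) (offspringPGFDeriv p t) t := by
  rw [hasDerivAt_iff_isLittleO]
  refine Asymptotics.IsBigO.trans_isLittleO ?_ (Asymptotics.isLittleO_pow_sub_sub t one_lt_two)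
  refine Asymptotics.IsBigO.of_bound (∑' k : ℕ, (p k).toReal * (k : ℝ) ^ 2) ?_
  filter_upwards [Ioo_mem_nhds ht ht1] with s hs
  have h1 := tangent_le_offspringPGF h2 hs.1.le hs.2.le ht.le ht1.le
  have h3 := offspringPGF_le_tangent_add_sq h2 hs.1.le hs.2.le ht.le ht1.le
  rw [Real.norm_eq_abs, abs_of_nonneg (by rw [smul_eq_mul]; linarith), smul_eq_mul, norm_pow,
    norm_norm, Real.norm_eq_abs, sq_abs]
  linarith

lemma tendsto_offspringPGF {s : ℕ → ℝ} {t : ℝ} (hs : ∀ n, 0 ≤ s n)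
    (hs1 : ∀ n, s n ≤ 1) (hlim : Tendsto s atTop (𝓝 t)) :
    Tendsto (fun n => offspringPGF p (s n)) atTop (𝓝 (offspringPGF p t)) := by
  have ht : 0 ≤ t := ge_of_tendsto' hlim hs
  have ht1 : t ≤ 1 := le_of_tendsto' hlim hs1
  have hsub : Tendsto (fun n => s n - t) atTop (𝓝 0) := by
    simpa using hlim.sub_const t
  refine tendsto_of_tendsto_of_tendsto_of_le_of_le
    (g := fun n => offspringPGF p t + offspringPGFDeriv p t * (s n - t))
    (h := fun n => offspringPGF p t + offspringPGFDeriv p t * (s n - t) +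
      (∑' k : ℕ, (p k).toReal * (k : ℝ) ^ 2) * (s n - t) ^ 2) ?_ ?_
    (fun n => tangent_le_offspringPGF h2 (hs n) (hs1 n) ht ht1)
    (fun n => offspringPGF_le_tangent_add_sq h2 (hs n) (hs1 n) ht ht1)
  · simpa using (hsub.const_mul (offspringPGFDeriv p t)).const_add (offspringPGF p t)
  · simpa using ((hsub.const_mul (offspringPGFDeriv p t)).const_add (offspringPGF p t)).add
      ((hsub.pow 2).const_mul (∑' k : ℕ, (p k).toReal * (k : ℝ) ^ 2))

variable (hmean : 1 < ∑' k : ℕ, (p k).toReal * (k : ℝ))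
include hmean

lemma exists_two_le_offspring : ∃ k : ℕ, 2 ≤ k ∧ 0 < (p k).toReal := by
  by_contra! h
  refine hmean.not_ge ?_
  rw [← (hasSum_toReal p).tsum_eq]
  refine (summable_mean h2).tsum_le_tsum (fun k => ?_) (hasSum_toReal p).summable
  by_cases hk : 2 ≤ k
  · rw [le_antisymm (h k hk) ENNReal.toReal_nonneg, zero_mul]
  · refine mul_le_of_le_one_right ENNReal.toReal_nonneg ?_
    exact_mod_cast (by omega : k ≤ 1)

/-- The probability generating function lies strictly below its chords ending at `1`. -/
lemma offspringPGF_lt_chord {s t : ℝ} (hs : 0 ≤ s) (hst : s < t) (ht : t < 1) :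
    (1 - s) * offspringPGF p t < (1 - t) * offspringPGF p s + (t - s) := by
  obtain ⟨k, hk, hpk⟩ := exists_two_le_offspring h2 hmean
  -- The tangent at `t`, evaluated at `s` and at `1` with weights `1 - t` and `t - s`: the slope
  -- terms cancel.
  have hconv : ∀ k : ℕ, (1 - s) * t ^ k ≤ (1 - t) * s ^ k + (t - s) := by
    intro k
    have h1 := tangent_le_pow hs (hs.trans hst.le) k
    have h3 := tangent_le_pow zero_le_one (hs.trans hst.le) k
    rw [one_pow] at h3
    nlinarith [mul_le_mul_of_nonneg_left h1 (sub_pos.2 ht).le,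
      mul_le_mul_of_nonneg_left h3 (sub_pos.2 hst).le]
  have hstrict : (1 - s) * t ^ k < (1 - t) * s ^ k + (t - s) := by
    have hne : (1 - s) ≠ 0 := by linarith
    have ha : 0 < (1 - t) / (1 - s) := div_pos (by linarith) (by linarith)
    have hb : 0 < (t - s) / (1 - s) := div_pos (by linarith) (by linarith)
    have h := (strictConvexOn_pow hk).2 (Set.mem_Ici.2 hs) (Set.mem_Ici.2 zero_le_one)
      (hst.trans ht).ne ha hb (by field_simp; ring)
    have he : ((1 - t) / (1 - s)) • s + ((t - s) / (1 - s)) • (1 : ℝ) = t := by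
      simp only [smul_eq_mul]; field_simp; ring
    simp only [he] at h
    simp only [smul_eq_mul, one_pow, mul_one] at h
    have h' := mul_lt_mul_of_pos_left h (by linarith : 0 < 1 - s)
    have he2 : (1 - s) * ((1 - t) / (1 - s) * s ^ k + (t - s) / (1 - s)) =
      (1 - t) * s ^ k + (t - s) := by field_simp
    rwa [he2] at h'
  have hst1 := summable_pgf (p := p) hs (hst.le.trans ht.le)
  have htt1 := summable_pgf (p := p) (hs.trans hst.le) ht.le
  have e1 : (1 - t) * offspringPGF p s + (t - s) =
      ∑' k : ℕ, (p k).toReal * ((1 - t) * s ^ k + (t - s)) := by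
    have : ∀ k : ℕ, (p k).toReal * ((1 - t) * s ^ k + (t - s)) =
      (1 - t) * ((p k).toReal * s ^ k) + (p k).toReal * (t - s) := fun k => by ring
    simp_rw [this]
    rw [(hst1.mul_left _).tsum_add ((hasSum_toReal p).summable.mul_right _), tsum_mul_left,
      tsum_mul_right, (hasSum_toReal p).tsum_eq, one_mul, offspringPGF]
  have e2 : (1 - s) * offspringPGF p t = ∑' k : ℕ, (p k).toReal * ((1 - s) * t ^ k) := by
    rw [offspringPGF, ← tsum_mul_left]
    exact tsum_congr fun k => by ring
  rw [e1, e2]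
  refine Summable.tsum_lt_tsum (i := k)
    (fun k => mul_le_mul_of_nonneg_left (hconv k) ENNReal.toReal_nonneg)
    (mul_lt_mul_of_pos_left hstrict hpk) ?_ ?_
  · exact (htt1.mul_left (1 - s)).congr fun k => by ring
  · exact ((hst1.mul_left (1 - t)).add ((hasSum_toReal p).summable.mul_right (t - s))).congr
      fun k => by ring

/-- A supercritical offspring law has growth factor above one near zero. -/
lemma exists_growth :
    ∃ ε > 0, ∃ δ > 0, δ ≤ 1 ∧ ∀ u, 0 ≤ u → u ≤ δ →
      (1 + ε) * u ≤ 1 - offspringPGF p (1 - u) := by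
  set M := ∑' k : ℕ, (p k).toReal * (k : ℝ) with hM
  set C := ∑' k : ℕ, (p k).toReal * (k : ℝ) ^ 2 with hC
  have hMC : M ≤ C := (summable_mean h2).tsum_le_tsum (fun k => by
    gcongr
    exact_mod_cast Nat.le_self_pow two_ne_zero k) h2
  have hC0 : 0 < C := by linarith
  have hd : offspringPGFDeriv p 1 = M := by simp [offspringPGFDeriv, hM]
  -- From `1 - f (1 - u) ≥ M * u - C * u ^ 2`: half of the excess `M - 1` becomes `ε`, the other
  -- half absorbs the square.
  refine ⟨(M - 1) / 2, by linarith, min 1 ((M - 1) / (2 * C)),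
    lt_min one_pos (div_pos (by linarith) (by linarith)), min_le_left _ _, fun u hu hud => ?_⟩
  have hu1 : u ≤ 1 := hud.trans (min_le_left _ _)
  have hu2 : u * (2 * C) ≤ M - 1 := (le_div_iff₀ (by linarith)).1 (hud.trans (min_le_right _ _))
  have h := offspringPGF_le_tangent_add_sq h2 (s := 1 - u) (t := 1) (by linarith) (by linarith)
    zero_le_one le_rfl
  rw [hd, offspringPGF_one, ← hC] at h
  nlinarith [mul_le_mul_of_nonneg_left hu2 hu]

/-- Growth at `δ` gives `f (1 - δ) ≤ 1 - δ`, so the iterates from `0` stay below `1 - δ` and their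
limit is a fixed point other than `1`. It is positive because `f q ≥ p 0`. -/
lemma extinction_fixedPoint (hp0 : 0 < p 0) {Q : ℕ → ℝ} {q : ℝ} (hQ0 : Q 0 = 0)
    (hQs : ∀ k, Q (k + 1) = offspringPGF p (Q k)) (hQ : Tendsto Q atTop (𝓝 q)) :
    0 < q ∧ q < 1 ∧ offspringPGF p q = q := by
  obtain ⟨ε, hε, δ, hδ, hδ1, hgr⟩ := exists_growth h2 hmean
  have hb : ∀ k, 0 ≤ Q k ∧ Q k ≤ 1 - δ := by
    intro k
    induction k with
    | zero => rw [hQ0]; constructor <;> linarith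
    | succ k ih =>
      rw [hQs]
      refine ⟨offspringPGF_nonneg ih.1, ?_⟩
      have h1 := offspringPGF_mono (p := p) ih.1 ih.2 (by linarith)
      have h3 := hgr δ hδ.le le_rfl
      nlinarith [mul_pos hε hδ]
  have hfix : offspringPGF p q = q := by
    refine tendsto_nhds_unique (tendsto_offspringPGF h2 (fun n => (hb n).1)
      (fun n => (hb n).2.trans (by linarith)) hQ) ?_
    simpa only [Function.comp_def, hQs] using hQ.comp (tendsto_add_atTop_nat 1)
  have hq0 : 0 ≤ q := ge_of_tendsto' hQ fun k => (hb k).1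
  have hq1 : q ≤ 1 - δ := le_of_tendsto' hQ fun k => (hb k).2
  refine ⟨?_, by linarith, hfix⟩
  rw [← hfix]
  have h0 : 0 < (p 0).toReal := ENNReal.toReal_pos hp0.ne' (p.apply_ne_top 0)
  refine h0.trans_le ?_
  have hq1' : q ≤ 1 := by linarith
  have := (summable_pgf (p := p) hq0 hq1').le_tsum 0 (fun k _ => by positivity)
  rwa [pow_zero, mul_one] at this

/-- At the fixed point `q`, the chord ending at `1` is the diagonal. -/
lemma offspringPGF_lt_self {q s : ℝ} (hq : 0 ≤ q) (hfix : offspringPGF p q = q) (hqs : q < s)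
    (hs : s < 1) : offspringPGF p s < s := by
  have h := offspringPGF_lt_chord h2 hmean hq hqs hs
  rw [hfix] at h
  have : (1 - q) * offspringPGF p s < (1 - q) * s := by linarith
  exact lt_of_mul_lt_mul_left this (by linarith)

lemma offspringPGFDeriv_pos {q : ℝ} (hq : 0 < q) (hq1 : q ≤ 1) : 0 < offspringPGFDeriv p q := by
  obtain ⟨k, hk, hpk⟩ := exists_two_le_offspring h2 hmean
  refine (summable_pgfDeriv h2 hq.le hq1).tsum_pos (fun k => by positivity) k ?_
  have : (0 : ℝ) < k := by exact_mod_cast (by omega : 0 < k)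
  positivity

/-- A tangent at `q` of slope at least one would stay above the diagonal, yet the function exceeds
its tangent and is below the diagonal at the midpoint of `q` and `1`. -/
lemma offspringPGFDeriv_lt_one {q : ℝ} (hq : 0 ≤ q) (hq1 : q < 1)
    (hfix : offspringPGF p q = q) : offspringPGFDeriv p q < 1 := by
  have h1 := offspringPGF_lt_self h2 hmean (s := (q + 1) / 2) hq hfix (by linarith) (by linarith)
  have h3 := tangent_le_offspringPGF h2 (s := (q + 1) / 2) (t := q) (by linarith) (by linarith)
    hq hq1.le
  rw [hfix] at h3
  by_contra! h
  nlinarith [mul_le_mul_of_nonneg_right h (by linarith : (0 : ℝ) ≤ (q + 1) / 2 - q)]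

end pgf

/-! ### Monotonicity of the jump generating function -/

/-- For either sign of `y`, the derivative `y * θ ^ (y - 1)` is at least `y` when `θ ≥ 1`. -/
lemma mul_sub_le_zpow_sub {s t : ℝ} (hs : 1 ≤ s) (hst : s ≤ t) (y : ℤ) :
    (y : ℝ) * (t - s) ≤ t ^ y - s ^ y := by
  have hs0 : 0 < s := by linarith
  have ht0 : 0 < t := by linarith
  obtain ⟨n, rfl | rfl⟩ := y.eq_nat_or_neg
  · have h := tangent_le_pow ht0.le hs0.le n
    have h1 : (n : ℝ) * 1 * (t - s) ≤ n * s ^ (n - 1) * (t - s) := by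
      gcongr
      exact one_le_pow₀ hs
    simp only [Int.cast_natCast, zpow_natCast]
    linarith
  · have h := tangent_le_pow (inv_nonneg.2 ht0.le) (inv_nonneg.2 hs0.le) n
    have h1 : s⁻¹ ^ (n - 1) ≤ 1 := pow_le_one₀ (inv_nonneg.2 hs0.le) (inv_le_one_of_one_le₀ hs)
    have h2 : s⁻¹ - t⁻¹ ≤ t - s := by
      rw [inv_sub_inv hs0.ne' ht0.ne', div_le_iff₀ (by positivity)]
      nlinarith [mul_le_mul hs (hs.trans hst) zero_le_one hs0.le]
    have h3 : 0 ≤ s⁻¹ - t⁻¹ := sub_nonneg.2 (inv_anti₀ hs0 hst)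
    have h4 : (n : ℝ) * s⁻¹ ^ (n - 1) * (s⁻¹ - t⁻¹) ≤ n * 1 * (t - s) := by gcongr
    simp only [Int.cast_neg, Int.cast_natCast, zpow_neg, zpow_natCast, ← inv_pow]
    linarith

lemma mul_sub_lt_zpow_sub {s t : ℝ} (hs : 1 ≤ s) (hst : s < t) {y : ℤ} (hy : y < 0) :
    (y : ℝ) * (t - s) < t ^ y - s ^ y := by
  obtain ⟨r, hsr, hrt⟩ := exists_between hst
  have hs0 : 0 < s := by linarith
  have hr0 : 0 < r := by linarith
  have ht0 : 0 < t := by linarith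
  have h1 := mul_sub_le_zpow_sub hs hsr.le y
  obtain ⟨n, rfl | rfl⟩ := y.eq_nat_or_neg
  · omega
  have hn : (0 : ℝ) < n := by exact_mod_cast (by omega : 0 < n)
  have h := tangent_le_pow (inv_nonneg.2 ht0.le) (inv_nonneg.2 hr0.le) n
  have h2 : r⁻¹ ^ (n - 1) ≤ 1 :=
    pow_le_one₀ (inv_nonneg.2 hr0.le) (inv_le_one_of_one_le₀ (hs.trans hsr.le))
  have h3 : r⁻¹ - t⁻¹ < t - r := by
    rw [inv_sub_inv hr0.ne' ht0.ne', div_lt_iff₀ (by positivity)]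
    have : 1 < r * t := by nlinarith
    nlinarith
  have h4 : 0 ≤ r⁻¹ - t⁻¹ := sub_nonneg.2 (inv_anti₀ hr0 hrt.le)
  have h5 : (n : ℝ) * r⁻¹ ^ (n - 1) * (r⁻¹ - t⁻¹) < n * (t - r) := by
    have : r⁻¹ ^ (n - 1) * (r⁻¹ - t⁻¹) ≤ r⁻¹ - t⁻¹ := mul_le_of_le_one_left h4 h2
    rw [mul_assoc]
    exact mul_lt_mul_of_pos_left (this.trans_lt h3) hn
  simp only [Int.cast_neg, Int.cast_natCast, zpow_neg, zpow_natCast, ← inv_pow] at h1 ⊢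
  linarith

section jump

variable {a : PMF ℤ}

lemma exists_ne_zero_jump (ha_nondeg : a 0 ≠ 1) : ∃ y : ℤ, y ≠ 0 ∧ 0 < (a y).toReal := by
  by_contra! h
  apply ha_nondeg
  rw [a.apply_eq_one_iff]
  ext y
  rw [PMF.mem_support_iff, Set.mem_singleton_iff]
  constructor
  · intro hy
    by_contra hy0
    exact (h y hy0).not_gt (ENNReal.toReal_pos hy (a.apply_ne_top y))
  · rintro rfl h0
    have hz : ∀ y, (a y).toReal = 0 := by
      intro y
      by_cases hy : y = 0
      · rw [hy, h0, ENNReal.toReal_zero]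
      · exact le_antisymm (h y hy) ENNReal.toReal_nonneg
    have := (hasSum_toReal a).tsum_eq
    simp [hz] at this

variable (ha_mean : HasSum (fun y : ℤ => (a y).toReal * (y : ℝ)) 0) (ha_nondeg : a 0 ≠ 1)
include ha_mean ha_nondeg

lemma exists_neg_jump : ∃ y : ℤ, y < 0 ∧ 0 < (a y).toReal := by
  by_contra! h
  obtain ⟨y, hy0, hy⟩ := exists_ne_zero_jump ha_nondeg
  have hnn : ∀ y : ℤ, 0 ≤ (a y).toReal * (y : ℝ) := by
    intro y
    rcases lt_or_ge y 0 with h' | h'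
    · rw [le_antisymm (h y h') ENNReal.toReal_nonneg, zero_mul]
    · exact mul_nonneg ENNReal.toReal_nonneg (by exact_mod_cast h')
  have := congrFun ((hasSum_zero_iff_of_nonneg hnn).1 ha_mean) y
  simp only [Pi.zero_apply, mul_eq_zero, Int.cast_eq_zero] at this
  rcases this with h' | h'
  · exact hy.ne' h'
  · exact hy0 h'

lemma exists_pos_jump : ∃ y : ℤ, 0 < y ∧ 0 < (a y).toReal := by
  by_contra! h
  obtain ⟨y, hy0, hy⟩ := exists_ne_zero_jump ha_nondeg
  have hnn : ∀ y : ℤ, 0 ≤ -((a y).toReal * (y : ℝ)) := by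
    intro y
    rcases lt_or_ge 0 y with h' | h'
    · rw [le_antisymm (h y h') ENNReal.toReal_nonneg, zero_mul, neg_zero]
    · rw [← mul_neg]
      exact mul_nonneg ENNReal.toReal_nonneg (by rw [neg_nonneg]; exact_mod_cast h')
  have h0 : HasSum (fun y : ℤ => -((a y).toReal * (y : ℝ))) 0 := by simpa using ha_mean.neg
  have := congrFun ((hasSum_zero_iff_of_nonneg hnn).1 h0) y
  simp only [Pi.zero_apply, neg_eq_zero, mul_eq_zero, Int.cast_eq_zero] at this
  rcases this with h' | h'
  · exact hy.ne' h'
  · exact hy0 h'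

variable (ha_pgf : ∀ θ : ℝ, 1 ≤ θ → Summable fun y : ℤ => (a y).toReal * θ ^ y)
include ha_pgf

/-- Averaging `y * (t - s) ≤ t ^ y - s ^ y` over the centred law makes the left side vanish. A
negative jump supplies strictness; jumps `0` and `1` give equality. -/
lemma jumpPGF_lt {s t : ℝ} (hs : 1 ≤ s) (hst : s < t) : jumpPGF a s < jumpPGF a t := by
  obtain ⟨y, hy, hay⟩ := exists_neg_jump ha_mean ha_nondeg
  have h0 : HasSum (fun y : ℤ => (a y).toReal * ((y : ℝ) * (t - s))) 0 := by
    simpa [mul_assoc] using ha_mean.mul_right (t - s)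
  have hd := (ha_pgf t (hs.trans hst.le)).sub (ha_pgf s hs)
  have hlt : 0 < ∑' y : ℤ, ((a y).toReal * t ^ y - (a y).toReal * s ^ y) := by
    rw [← h0.tsum_eq]
    refine Summable.tsum_lt_tsum (i := y) (fun z => ?_) ?_ h0.summable hd
    · rw [← mul_sub]
      exact mul_le_mul_of_nonneg_left (mul_sub_le_zpow_sub hs hst.le z) ENNReal.toReal_nonneg
    · rw [← mul_sub]
      exact mul_lt_mul_of_pos_left (mul_sub_lt_zpow_sub hs hst hy) hay
  rw [(ha_pgf t (hs.trans hst.le)).tsum_sub (ha_pgf s hs)] at hlt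
  exact sub_pos.1 hlt

omit ha_mean ha_nondeg in
lemma continuousOn_jumpPGF (B : ℝ) (hB : 1 ≤ B) : ContinuousOn (jumpPGF a) (Set.Icc 1 B) := by
  refine continuousOn_tsum (u := fun y : ℤ => (a y).toReal * 1 ^ y + (a y).toReal * B ^ y)
    (fun y => ?_) ((ha_pgf 1 le_rfl).add (ha_pgf B hB)) fun y s hs => ?_
  · exact continuousOn_const.mul
      (continuousOn_id.zpow₀ y fun s hs => Or.inl (by have := hs.1; simp only [id]; linarith))
  · have hs0 : 0 < s := by linarith [hs.1]
    have hB0 : 0 < B := by linarith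
    rw [Real.norm_of_nonneg (by positivity), ← mul_add]
    refine mul_le_mul_of_nonneg_left ?_ ENNReal.toReal_nonneg
    rcases le_total 0 y with hy | hy
    · have := zpow_le_zpow_left₀ hy hs0.le hs.2
      rw [one_zpow]; linarith
    · have h1 : s ^ y ≤ 1 := zpow_le_one_of_nonpos₀ hs.1 hy
      have h2 : 0 < B ^ y := zpow_pos hB0 y
      rw [one_zpow]; linarith

lemma existsUnique_jumpPGF_eq {γ : ℝ} (hγ : 1 < γ) : ∃! s : ℝ, 1 < s ∧ jumpPGF a s = γ := by
  have h1 : jumpPGF a 1 = 1 := by simp [jumpPGF, (hasSum_toReal a).tsum_eq]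
  obtain ⟨y, hy, hay⟩ := exists_pos_jump ha_mean ha_nondeg
  -- Chosen so that the single term at `y` already reaches `γ`, since `B ^ y ≥ B`.
  set B := γ / (a y).toReal with hBdef
  have hB : 1 ≤ B := (one_le_div hay).2 ((toReal_le_one a y).trans hγ.le)
  have hKB : γ ≤ jumpPGF a B := by
    have h2 : (a y).toReal * B ^ y ≤ jumpPGF a B :=
      (ha_pgf B hB).le_tsum y fun z _ => by positivity
    have h3 : B ≤ B ^ y := by
      simpa using zpow_le_zpow_right₀ hB (show (1 : ℤ) ≤ y by omega)
    have h4 : (a y).toReal * B = γ := by rw [hBdef]; field_simp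
    nlinarith [mul_le_mul_of_nonneg_left h3 hay.le]
  obtain ⟨s, hs, hsγ⟩ := intermediate_value_Icc hB (continuousOn_jumpPGF ha_pgf B hB)
    ⟨h1.trans_le hγ.le, hKB⟩
  have hs1 : 1 < s := lt_of_le_of_ne hs.1 fun h => by rw [← h, h1] at hsγ; exact hγ.ne hsγ
  refine ⟨s, ⟨hs1, hsγ⟩, fun t ht => ?_⟩
  rcases lt_trichotomy t s with h | h | h
  · exact absurd (jumpPGF_lt ha_mean ha_nondeg ha_pgf ht.1.le h) (by rw [ht.2, hsγ]; simp)
  · exact h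
  · exact absurd (jumpPGF_lt ha_mean ha_nondeg ha_pgf hs1.le h) (by rw [ht.2, hsγ]; simp)

end jump

/-! ### The tail stays above the survival probability -/

/-- Sums of a decreasing function over a window, compared with those over a shifted window. -/
lemma sum_window_shift_ge {v : ℤ → ℝ} (hanti : Antitone v) (hv : ∀ n, 0 ≤ v n) (m : ℤ) (N : ℕ)
    (y : ℤ) :
    ∑ i ∈ Finset.range N, v (m + i) + (y * v m - |(y : ℝ)| * v (m + N - y)) ≤
      ∑ i ∈ Finset.range N, v (m + i - y) := by
  -- Each unit shift to the left gains a value at the left end and loses one at the right end. By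
  -- monotonicity the left end contributes at least `y * v m`, for either sign of `y`.
  have step : ∀ y : ℤ, ∑ i ∈ Finset.range N, v (m + i - (y + 1)) =
      ∑ i ∈ Finset.range N, v (m + i - y) + v (m - (y + 1)) - v (m + N - (y + 1)) := by
    intro y
    have h := Finset.sum_range_sub' (fun i : ℕ => v (m + i - (y + 1))) N
    rw [Finset.sum_sub_distrib] at h
    have h' : ∀ i : ℕ, m + ((i + 1 : ℕ) : ℤ) - (y + 1) = m + i - y := by intro i; push_cast; ring
    simp only [h', Nat.cast_zero, add_zero] at h
    linarith
  obtain ⟨k, rfl | rfl⟩ := y.eq_nat_or_neg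
  · simp only [Int.cast_natCast, Nat.abs_cast]
    induction k with
    | zero => simp
    | succ k ih =>
      have h1 := step k
      have h2 : v m ≤ v (m - (k + 1)) := hanti (by omega)
      have h3 : v (m + N - k) ≤ v (m + N - (k + 1)) := hanti (by omega)
      have h4 : (k : ℝ) * v (m + N - k) ≤ k * v (m + N - (k + 1)) := by gcongr
      push_cast
      linarith
  · have key : ∑ i ∈ Finset.range N, v (m + i) - k * v m ≤
        ∑ i ∈ Finset.range N, v (m + i - (-(k : ℤ))) := by
      induction k with
      | zero => simp
      | succ k ih =>
        have h1 := step (-((k + 1 : ℕ) : ℤ))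
        rw [show -((k + 1 : ℕ) : ℤ) + 1 = -(k : ℤ) by push_cast; ring] at h1
        have h2 : v (m - -(k : ℤ)) ≤ v m := hanti (by omega)
        have h3 := hv (m + N - -(k : ℤ))
        push_cast at h1 ih ⊢
        linarith
    have h5 := mul_nonneg (abs_nonneg ((-(k : ℤ) : ℤ) : ℝ)) (hv (m + N - (-(k : ℤ))))
    push_cast at h5 ⊢
    linarith

section decay

variable {a : PMF ℤ} (ha_mean : HasSum (fun y : ℤ => (a y).toReal * (y : ℝ)) 0)

lemma summable_mul_of_bounded {v : ℤ → ℝ} {C : ℝ} (hv : ∀ n, |v n| ≤ C) :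
    Summable fun y : ℤ => (a y).toReal * v y :=
  ((hasSum_toReal a).summable.mul_right C).of_norm_bounded fun y => by
    rw [norm_mul, Real.norm_of_nonneg ENNReal.toReal_nonneg]
    exact mul_le_mul_of_nonneg_left (hv y) ENNReal.toReal_nonneg

lemma tendsto_tsum_jump {ι : Type*} {l : Filter ι} {F : ι → ℤ → ℝ} {g : ℤ → ℝ} {C : ℝ}
    (hF : ∀ y, Tendsto (F · y) l (𝓝 (g y))) (hC : ∀ i y, |F i y| ≤ C) :
    Tendsto (fun i => ∑' y : ℤ, (a y).toReal * F i y) l (𝓝 (∑' y : ℤ, (a y).toReal * g y)) := by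
  refine tendsto_tsum_of_dominated_convergence ((hasSum_toReal a).summable.mul_right C)
    (fun y => (hF y).const_mul _) (.of_forall fun i y => ?_)
  rw [norm_mul, Real.norm_of_nonneg ENNReal.toReal_nonneg]
  exact mul_le_mul_of_nonneg_left (hC i y) ENNReal.toReal_nonneg

lemma tendsto_add_natCast_sub (m y : ℤ) : Tendsto (fun N : ℕ => m + N - y) atTop atTop := by
  simpa only [sub_eq_add_neg] using tendsto_atTop_add_const_right _ (-y)
    (tendsto_atTop_add_const_left _ m (tendsto_natCast_atTop_atTop (R := ℤ)))

include ha_mean in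
/-- A bounded decreasing function tending to zero that dominates a multiple greater than one of
its averages along a centred walk vanishes. -/
lemma eq_zero_of_growth {v : ℤ → ℝ} (hanti : Antitone v) (hv : ∀ n, 0 ≤ v n)
    (hv1 : ∀ n, v n ≤ 1) (hlim : Tendsto v atTop (𝓝 0)) {ε : ℝ} (hε : 0 < ε) {m : ℤ}
    (hgrow : ∀ n, m ≤ n → (1 + ε) * ∑' y : ℤ, (a y).toReal * v (n - y) ≤ v n) :
    v m = 0 := by
  have hvabs : ∀ n, |v n| ≤ 1 := fun n => by rw [abs_of_nonneg (hv n)]; exact hv1 n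
  have habs : Summable fun y : ℤ => (a y).toReal * |(y : ℝ)| := by
    refine ha_mean.summable.abs.congr fun y => ?_
    rw [abs_mul, abs_of_nonneg ENNReal.toReal_nonneg]
  have herr : ∀ N : ℕ, Summable fun y : ℤ => (a y).toReal * |(y : ℝ)| * v (m + N - y) := fun N =>
    habs.of_nonneg_of_le (fun y => mul_nonneg (by positivity) (hv _))
      fun y => mul_le_of_le_one_right (by positivity) (hv1 _)
  have hlimE : Tendsto (fun N : ℕ => ∑' y : ℤ, (a y).toReal * |(y : ℝ)| * v (m + N - y)) atTop
      (𝓝 0) := by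
    have := tendsto_tsum_of_dominated_convergence (𝓕 := atTop) habs
      (f := fun (N : ℕ) (y : ℤ) => (a y).toReal * |(y : ℝ)| * v (m + N - y)) (g := fun _ => 0)
      (fun y => by
        simpa using (hlim.comp (tendsto_add_natCast_sub m y)).const_mul
          ((a y).toReal * |(y : ℝ)|))
      (.of_forall fun N y => by
        rw [Real.norm_of_nonneg (mul_nonneg (by positivity) (hv _))]
        exact mul_le_of_le_one_right (by positivity) (hv1 _))
    simpa using this
  -- Sum the growth inequality over the window. The term `y * v m` averages to zero, leaving `ε * S
  -- ≤ (1 + ε) * error`; the error at the far end tends to zero by dominated convergence.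
  have hmain : ∀ N : ℕ, ε * v m ≤
      (1 + ε) * ∑' y : ℤ, (a y).toReal * |(y : ℝ)| * v (m + (N + 1 : ℕ) - y) := by
    intro N
    set S := ∑ i ∈ Finset.range (N + 1), v (m + i) with hS
    have hSv : v m ≤ S := by
      have := Finset.single_le_sum (f := fun i : ℕ => v (m + i)) (fun i _ => hv _)
        (Finset.mem_range.2 (Nat.succ_pos N))
      simpa using this
    have hterm : ∀ i : ℕ, Summable fun y : ℤ => (a y).toReal * v (m + i - y) := fun i =>
      summable_mul_of_bounded fun y => hvabs _
    have h1 : (1 + ε) * ∑' y : ℤ, (a y).toReal * ∑ i ∈ Finset.range (N + 1), v (m + i - y)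
        ≤ S := by
      simp_rw [Finset.mul_sum]
      rw [Summable.tsum_finsetSum fun i _ => hterm i, Finset.mul_sum]
      exact Finset.sum_le_sum fun i _ => hgrow _ (by omega)
    have hsumL : Summable fun y : ℤ => (a y).toReal *
        (S + (y * v m - |(y : ℝ)| * v (m + (N + 1 : ℕ) - y))) := by
      refine (((hasSum_toReal a).summable.mul_right S).add
        ((ha_mean.summable.mul_right (v m)).sub (herr (N + 1)))).congr fun y => ?_
      ring
    have h2 : ∑' y : ℤ, (a y).toReal * (S + (y * v m - |(y : ℝ)| * v (m + (N + 1 : ℕ) - y))) =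
        S - ∑' y : ℤ, (a y).toReal * |(y : ℝ)| * v (m + (N + 1 : ℕ) - y) := by
      have := (((hasSum_toReal a).mul_right S).add
        ((ha_mean.mul_right (v m)).sub (herr (N + 1)).hasSum)).tsum_eq
      rw [one_mul, zero_mul, zero_sub, ← sub_eq_add_neg] at this
      rw [← this]
      exact tsum_congr fun y => by ring
    have h3 : ∑' y : ℤ, (a y).toReal * (S + (y * v m - |(y : ℝ)| * v (m + (N + 1 : ℕ) - y))) ≤
        ∑' y : ℤ, (a y).toReal * ∑ i ∈ Finset.range (N + 1), v (m + i - y) := by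
      refine hsumL.tsum_le_tsum (fun y => mul_le_mul_of_nonneg_left
        (sum_window_shift_ge hanti hv m (N + 1) y) ENNReal.toReal_nonneg) ?_
      simp_rw [Finset.mul_sum]
      exact summable_sum fun i _ => hterm i
    rw [h2] at h3
    have h4 := mul_le_mul_of_nonneg_left h3 (by linarith : 0 ≤ 1 + ε)
    nlinarith [mul_le_mul_of_nonneg_left hSv hε.le]
  have h0 : ε * v m ≤ 0 := by
    have hlim' := (hlimE.comp (tendsto_add_atTop_nat 1)).const_mul (1 + ε)
    rw [mul_zero] at hlim'
    exact ge_of_tendsto' hlim' hmain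
  exact le_antisymm (nonpos_of_mul_nonpos_right h0 hε) (hv m)

variable {p : PMF ℕ} (h2 : Summable fun k : ℕ => (p k).toReal * (k : ℝ) ^ 2)
  (hmean : 1 < ∑' k : ℕ, (p k).toReal * (k : ℝ)) (ha_nondeg : a 0 ≠ 1)
include h2 hmean ha_mean ha_nondeg

/-- The maximum exceeds every level with at least the survival probability. -/
lemma survival_le_of_recursion {u : ℤ → ℝ} (hanti : Antitone u) (hu0 : ∀ n, 0 ≤ u n)
    (hu1 : ∀ n, u n ≤ 1) (hneg : ∀ n ≤ 0, u n = 1)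
    (hrec : ∀ n, 0 < n → u n = 1 - ∑' y : ℤ, (a y).toReal * offspringPGF p (1 - u (n - y)))
    {q : ℝ} (hq : 0 ≤ q) (hfix : offspringPGF p q = q) (n : ℤ) : 1 - q ≤ u n := by
  obtain ⟨ε, hε, δ, hδ, hδ1, hgr⟩ := exists_growth h2 hmean
  have hFabs : ∀ n, |offspringPGF p (1 - u n)| ≤ 1 := fun n => by
    rw [abs_of_nonneg (offspringPGF_nonneg (by linarith [hu1 n]))]
    exact offspringPGF_le_one (by linarith [hu1 n]) (by linarith [hu0 n])
  have hrec' : ∀ n, 0 < n →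
      u n = ∑' y : ℤ, (a y).toReal * (1 - offspringPGF p (1 - u (n - y))) := by
    intro n hn
    have hs : Summable fun y : ℤ => (a y).toReal * offspringPGF p (1 - u (n - y)) :=
      summable_mul_of_bounded fun y => hFabs _
    simp_rw [mul_sub, mul_one]
    rw [(hasSum_toReal a).summable.tsum_sub hs, (hasSum_toReal a).tsum_eq, hrec n hn]
  have hGmono : ∀ s t, 0 ≤ s → s ≤ t → t ≤ 1 →
      1 - offspringPGF p (1 - s) ≤ 1 - offspringPGF p (1 - t) := fun s t hs hst ht =>
    sub_le_sub_left (offspringPGF_mono (by linarith) (by linarith) (by linarith)) _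
  have hGmin : ∀ s, 0 ≤ s → s ≤ 1 → (1 + ε) * min s δ ≤ 1 - offspringPGF p (1 - s) :=
    fun s hs hs1 => (hgr _ (le_min hs hδ.le) (min_le_right _ _)).trans
      (hGmono _ _ (le_min hs hδ.le) (min_le_left _ _) hs1)
  have hsG : ∀ n, Summable fun y : ℤ => (a y).toReal * (1 - offspringPGF p (1 - u (n - y))) :=
    fun n => summable_mul_of_bounded (C := 2) fun y => by
      have := abs_le.1 (hFabs (n - y)); rw [abs_le]; constructor <;> linarith
  have hGnn : ∀ n, 0 ≤ 1 - offspringPGF p (1 - u n) := fun n => by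
    linarith [(abs_le.1 (hFabs n)).2]
  have hpos : ∀ k : ℕ, ∀ n : ℤ, n ≤ k → 0 < u n := by
    obtain ⟨y, hy, hay⟩ := exists_pos_jump ha_mean ha_nondeg
    intro k
    induction k with
    | zero => intro n hn; rw [hneg n (by simpa using hn)]; exact one_pos
    | succ k ih =>
      intro n hn
      rcases le_or_gt n 0 with h | h
      · rw [hneg n h]; exact one_pos
      · rw [hrec' n h]
        refine (hsG n).tsum_pos (fun z => mul_nonneg ENNReal.toReal_nonneg (hGnn _)) y
          (mul_pos hay ?_)
        have h3 := hGmin _ (hu0 (n - y)) (hu1 (n - y))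
        have h4 : 0 < min (u (n - y)) δ := lt_min (ih _ (by push_cast at hn; omega)) hδ
        nlinarith [mul_pos hε h4]
  obtain ⟨L, hL⟩ : ∃ L, Tendsto u atTop (𝓝 L) :=
    ⟨_, tendsto_atTop_ciInf hanti ⟨0, by rintro _ ⟨n, rfl⟩; exact hu0 n⟩⟩
  have hL0 : 0 ≤ L := ge_of_tendsto' hL hu0
  have hL1 : L ≤ 1 := le_of_tendsto' hL hu1
  -- Let the level tend to infinity in the recursion.
  have hLfix : L = 1 - offspringPGF p (1 - L) := by
    have h3 : Tendsto (fun N : ℕ => ∑' y : ℤ, (a y).toReal *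
        (offspringPGF p (1 - u (1 + N - y)))) atTop
        (𝓝 (∑' y : ℤ, (a y).toReal * (offspringPGF p (1 - L)))) := by
      refine tendsto_tsum_jump (C := 1) (fun y => ?_) fun N y => hFabs _
      exact tendsto_offspringPGF h2 (fun N => by linarith [hu1 (1 + N - y)])
        (fun N => by linarith [hu0 (1 + N - y)])
        ((hL.comp (tendsto_add_natCast_sub 1 y)).const_sub 1)
    rw [tsum_mul_right, (hasSum_toReal a).tsum_eq, one_mul] at h3
    have h4 := hL.comp (tendsto_add_natCast_sub 1 0)
    refine tendsto_nhds_unique h4 ((h3.const_sub 1).congr fun N => ?_)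
    simp only [Function.comp_apply, sub_zero]
    rw [hrec _ (by omega)]
  refine le_trans ?_ (hanti.le_of_tendsto hL n)
  rcases hL0.eq_or_lt with h0 | hLpos
  · exfalso
    subst h0
    obtain ⟨m, hm⟩ := eventually_atTop.1 (hL.eventually (ge_mem_nhds hδ))
    -- Growth holds only up to `δ`, while the averages also see levels where `u` is large; capping
    -- at `δ` repairs this. From level `m` on the cap is inactive, and from level `1` on the
    -- recursion holds.
    have hv0 := eq_zero_of_growth ha_mean (v := fun n => min (u n) δ) (m := max m 1)
      (fun _ _ h => min_le_min_right _ (hanti h)) (fun n => le_min (hu0 n) hδ.le)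
      (fun n => (min_le_right _ _).trans hδ1)
      (by simpa [hδ.le] using hL.min (tendsto_const_nhds (x := δ))) hε (by
        intro n hn
        have hmn : m ≤ n := (le_max_left _ _).trans hn
        rw [min_eq_left (hm n hmn), hrec' n (by have := le_max_right m 1; omega), ← tsum_mul_left]
        refine Summable.tsum_le_tsum (fun y => ?_) ?_ (hsG n)
        · rw [mul_left_comm]
          exact mul_le_mul_of_nonneg_left (hGmin _ (hu0 _) (hu1 _)) ENNReal.toReal_nonneg
        · refine Summable.mul_left _ (summable_mul_of_bounded (C := 1) fun y => ?_)
          rw [abs_of_nonneg (le_min (hu0 _) hδ.le)]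
          exact (min_le_right _ _).trans hδ1)
    have : 0 < min (u (max m 1)) δ :=
      lt_min (hpos (max m 1).toNat _ (Int.self_le_toNat _)) hδ
    exact this.ne' hv0
  -- Otherwise `1 - L` would be a fixed point strictly between `q` and `1`.
  · by_contra! h
    have := offspringPGF_lt_self h2 hmean hq hfix (s := 1 - L) (by linarith) (by linarith)
    linarith

end decay

/-! ### The subcritical recursion: comparison and lower bound -/

/-- A function `w` on `ℤ` solving the recursion `w n = ∑ y, a y * g (w (n - y))` for `0 < n`, where
`g` has slope `m < 1` at the origin, and decaying at the rate `ρ` of the linearised recursion. -/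
structure SubcriticalRecursion (a : PMF ℤ) (g : ℝ → ℝ) (q m C ρ : ℝ) (w : ℤ → ℝ) : Prop where
  q_pos : 0 < q
  m_pos : 0 < m
  m_lt_one : m < 1
  C_nonneg : 0 ≤ C
  one_lt_rho : 1 < ρ
  hasSum_rho : HasSum (fun y : ℤ => (a y).toReal * ρ ^ y) m⁻¹
  summable_sq : Summable fun y : ℤ => (a y).toReal * (ρ ^ 2) ^ y
  one_lt_sq : 1 < m * ∑' y : ℤ, (a y).toReal * (ρ ^ 2) ^ y
  g_pos : ∀ s, 0 < s → s ≤ q → 0 < g s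
  g_mono : ∀ s t, 0 ≤ s → s ≤ t → t ≤ q → g s ≤ g t
  g_lip : ∀ s t, 0 ≤ s → s ≤ t → t ≤ q → g t - g s ≤ m * (t - s)
  g_le : ∀ s, 0 ≤ s → s ≤ q → g s ≤ m * s
  le_g : ∀ s, 0 ≤ s → s ≤ q → m * s - C * s ^ 2 ≤ g s
  nonneg : ∀ n, 0 ≤ w n
  le_q : ∀ n, w n ≤ q
  le_rho : ∀ n, w n ≤ q * ρ ^ (-n)
  of_nonpos : ∀ n ≤ 0, w n = q
  recursion : ∀ n, 0 < n → w n = ∑' y : ℤ, (a y).toReal * g (w (n - y))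
  pos_jump : ∃ y : ℤ, 0 < y ∧ 0 < (a y).toReal

namespace SubcriticalRecursion

variable {a : PMF ℤ} {g : ℝ → ℝ} {q m C ρ : ℝ} {w : ℤ → ℝ}
  (h : SubcriticalRecursion a g q m C ρ w)
include h

lemma rho_pos : 0 < ρ := zero_lt_one.trans h.one_lt_rho

lemma g_nonneg {s : ℝ} (hs : 0 ≤ s) (hsq : s ≤ q) : 0 ≤ g s := by
  rcases hs.eq_or_lt with rfl | hs
  · simpa using h.le_g 0 le_rfl hsq
  · exact (h.g_pos s hs hsq).le

lemma g_abs_le {s : ℝ} (hs : 0 ≤ s) (hsq : s ≤ q) : |g s| ≤ q := by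
  rw [abs_of_nonneg (h.g_nonneg hs hsq)]
  exact (h.g_le s hs hsq).trans ((mul_le_of_le_one_left hs h.m_lt_one.le).trans hsq)

lemma summable_g {v : ℤ → ℝ} (hv : ∀ n, 0 ≤ v n) (hvq : ∀ n, v n ≤ q) (n : ℤ) :
    Summable fun y : ℤ => (a y).toReal * g (v (n - y)) :=
  summable_mul_of_bounded fun _ => h.g_abs_le (hv _) (hvq _)

lemma pos_aux (k : ℕ) : ∀ n : ℤ, n ≤ k → 0 < w n := by
  obtain ⟨y, hy, hay⟩ := h.pos_jump
  induction k with
  | zero => intro n hn; rw [h.of_nonpos n (by simpa using hn)]; exact h.q_pos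
  | succ k ih =>
    intro n hn
    rcases le_or_gt n 0 with h' | h'
    · rw [h.of_nonpos n h']; exact h.q_pos
    · rw [h.recursion n h']
      refine (h.summable_g h.nonneg h.le_q n).tsum_pos
        (fun z => mul_nonneg ENNReal.toReal_nonneg (h.g_nonneg (h.nonneg _) (h.le_q _))) y
        (mul_pos hay (h.g_pos _ (ih _ (by push_cast at hn; omega)) (h.le_q _)))

lemma pos (n : ℤ) : 0 < w n := h.pos_aux n.toNat n (Int.self_le_toNat n)

lemma tendsto_rho_neg : Tendsto (fun n : ℤ => ρ ^ (-n)) atTop (𝓝 0) := by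
  have h1 : Tendsto (fun n : ℕ => (ρ⁻¹) ^ n) atTop (𝓝 0) :=
    tendsto_pow_atTop_nhds_zero_of_lt_one (inv_nonneg.2 h.rho_pos.le)
      (inv_lt_one_of_one_lt₀ h.one_lt_rho)
  have h2 : Tendsto Int.toNat atTop atTop :=
    tendsto_atTop.2 fun b => (eventually_ge_atTop (b : ℤ)).mono fun n hn => by omega
  refine (h1.comp h2).congr' ?_
  filter_upwards [eventually_ge_atTop 0] with n hn
  simp only [Function.comp_apply]
  rw [zpow_neg, inv_pow, ← zpow_natCast, Int.toNat_of_nonneg hn]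

lemma tendsto_zero : Tendsto w atTop (𝓝 0) :=
  squeeze_zero h.nonneg h.le_rho (by simpa using h.tendsto_rho_neg.const_mul q)

/-- Comparison principle: subsolutions lie below the solution. -/
lemma subsolution_le {W : ℤ → ℝ} {M : ℤ} (hM : 0 < M) (hW0 : ∀ n, 0 ≤ W n) (hWq : ∀ n, W n ≤ q)
    (hWlim : Tendsto W atTop (𝓝 0)) (hWM : ∀ n < M, W n ≤ w n)
    (hWsub : ∀ n, M ≤ n → W n ≤ ∑' y : ℤ, (a y).toReal * g (W (n - y))) (n : ℤ) :
    W n ≤ w n := by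
  by_contra! hn
  have hlim : Tendsto (fun n => W n - w n) atTop (𝓝 0) := by
    simpa using hWlim.sub h.tendsto_zero
  obtain ⟨M', hM'⟩ := eventually_atTop.1 (hlim.eventually (gt_mem_nhds (sub_pos.2 hn)))
  have hmem : n ∈ Finset.Icc M M' := by
    rw [Finset.mem_Icc]
    constructor
    · by_contra! hlt
      exact (hWM n hlt).not_gt hn
    · by_contra! hlt
      exact lt_irrefl _ (hM' n hlt.le)
  -- Since `W - w` tends to zero and is nonpositive below `M`, a positive value forces a global
  -- maximum, attained at some `k`. There the recursion bounds the excess by `m < 1` times itself.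
  obtain ⟨k, hk, hmax⟩ := Finset.exists_max_image (Finset.Icc M M') (fun n => W n - w n) ⟨n, hmem⟩
  have hkn := hmax n hmem
  have hall : ∀ j, W j - w j ≤ W k - w k := by
    intro j
    rcases lt_or_ge j M with hj | hj
    · have := hWM j hj; linarith
    · rcases le_or_gt j M' with hj' | hj'
      · exact hmax j (Finset.mem_Icc.2 ⟨hj, hj'⟩)
      · have := hM' j hj'.le; linarith
  have hkM : M ≤ k := (Finset.mem_Icc.1 hk).1
  have hterm : ∀ j, g (W j) - g (w j) ≤ m * (W k - w k) := by
    intro j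
    rcases le_total (w j) (W j) with hj | hj
    · exact (h.g_lip _ _ (h.nonneg j) hj (hWq j)).trans
        (mul_le_mul_of_nonneg_left (hall j) h.m_pos.le)
    · have := h.g_mono _ _ (hW0 j) hj (h.le_q j)
      have := mul_pos h.m_pos (by linarith : 0 < W k - w k)
      linarith
  have hsW := h.summable_g hW0 hWq k
  have hsw := h.summable_g h.nonneg h.le_q k
  have h1 : W k - w k ≤ m * (W k - w k) := by
    calc W k - w k ≤ ∑' y : ℤ, (a y).toReal * g (W (k - y)) -
          ∑' y : ℤ, (a y).toReal * g (w (k - y)) := by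
            rw [← h.recursion k (by omega)]
            linarith [hWsub k hkM]
      _ = ∑' y : ℤ, ((a y).toReal * g (W (k - y)) - (a y).toReal * g (w (k - y))) :=
          (hsW.tsum_sub hsw).symm
      _ ≤ ∑' y : ℤ, (a y).toReal * (m * (W k - w k)) := by
          refine (hsW.sub hsw).tsum_le_tsum (fun y => ?_)
            ((hasSum_toReal a).summable.mul_right _)
          rw [← mul_sub]
          exact mul_le_mul_of_nonneg_left (hterm _) ENNReal.toReal_nonneg
      _ = m * (W k - w k) := by rw [tsum_mul_right, (hasSum_toReal a).tsum_eq, one_mul]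
  nlinarith [h.m_lt_one]

/-- The solution decays no faster than `ρ ^ (-n)`. -/
lemma exists_lower_bound : ∃ c > 0, ∀ n : ℕ, c ≤ ρ ^ n * w n := by
  -- The square of `ρ ^ (-n)` is `θ ^ (-n)`, so a second exponential at rate `θ` matches the
  -- quadratic error of `g`; its gain is `m * K - 1 = 2 * η`.
  set θ : ℝ := ρ ^ 2 with hθ
  have hρ0 := h.rho_pos
  have hθ0 : 0 < θ := by positivity
  have hρθ : ρ ≤ θ := by rw [hθ]; nlinarith [h.one_lt_rho]
  set K := ∑' y : ℤ, (a y).toReal * θ ^ y with hK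
  have hK1 : 1 < m * K := h.one_lt_sq
  have hK0 : 0 < K := pos_of_mul_pos_right (by linarith : 0 < m * K) h.m_pos.le
  set η := (m * K - 1) / 2 with hη
  have hη0 : 0 < η := by rw [hη]; linarith
  have hbT : ∀ n y : ℤ, (a y).toReal * θ ^ y * (if n < y then 1 else 0) ≤ (a y).toReal * θ ^ y :=
    fun n y => mul_le_of_le_one_right (by positivity) (by split_ifs <;> norm_num)
  have hnT : ∀ n y : ℤ, 0 ≤ (a y).toReal * θ ^ y * (if n < y then 1 else 0) := fun n y =>
    mul_nonneg (by positivity) (by split_ifs <;> norm_num)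
  have hsT : ∀ n : ℤ, Summable fun y : ℤ => (a y).toReal * θ ^ y * (if n < y then 1 else 0) :=
    fun n => h.summable_sq.of_nonneg_of_le (hnT n) (hbT n)
  -- This tail measures the loss from setting the subsolution to zero on negative levels, reached by
  -- jumps `y > n`.
  have hT : Tendsto (fun n : ℤ => ∑' y : ℤ, (a y).toReal * θ ^ y * (if n < y then 1 else 0))
      atTop (𝓝 0) := by
    have := tendsto_tsum_of_dominated_convergence (𝓕 := atTop) h.summable_sq
      (f := fun (n : ℤ) (y : ℤ) => (a y).toReal * θ ^ y * (if n < y then (1 : ℝ) else 0))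
      (g := fun _ => 0)
      (fun y => tendsto_const_nhds.congr' (by
        filter_upwards [eventually_ge_atTop y] with n hn
        rw [if_neg hn.not_gt, mul_zero]))
      (.of_forall fun n y => by
        rw [Real.norm_of_nonneg (hnT n y)]
        exact hbT n y)
    simpa using this
  obtain ⟨M₀, hM₀⟩ := eventually_atTop.1
    ((hT.const_mul (2 * m)).eventually (ge_mem_nhds (by rw [mul_zero]; exact hη0)))
  set M := max M₀ 1 with hMdef
  have hM : 0 < M := by have := le_max_right M₀ 1; omega
  obtain ⟨j₀, -, hmin⟩ := Finset.exists_min_image (Finset.Icc 0 M) w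
    ⟨0, Finset.mem_Icc.2 ⟨le_rfl, hM.le⟩⟩
  -- As `W ≤ 2 * c`, these put `W` below `w` on the initial stretch, keep it in the domain of `g`,
  -- and limit the quadratic loss to `η`; the cut costs the other `η`.
  obtain ⟨c, hc, hcw, hcq, hcC⟩ : ∃ c > 0, 2 * c ≤ w j₀ ∧ 2 * c ≤ q ∧ 4 * c * C * K ≤ η := by
    have hD : 0 < 4 * (C + 1) * K := by have := h.C_nonneg; positivity
    have hwj := h.pos j₀
    have hq := h.q_pos
    refine ⟨min (min (w j₀ / 2) (q / 2)) (η / (4 * (C + 1) * K)),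
      lt_min (lt_min (by linarith) (by linarith)) (div_pos hη0 hD), ?_, ?_, ?_⟩
    · have h1 : min (min (w j₀ / 2) (q / 2)) (η / (4 * (C + 1) * K)) ≤ w j₀ / 2 :=
        (min_le_left _ _).trans (min_le_left _ _)
      linarith
    · have h1 : min (min (w j₀ / 2) (q / 2)) (η / (4 * (C + 1) * K)) ≤ q / 2 :=
        (min_le_left _ _).trans (min_le_right _ _)
      linarith
    · set c := min (min (w j₀ / 2) (q / 2)) (η / (4 * (C + 1) * K))
      have h1 : c ≤ η / (4 * (C + 1) * K) := min_le_right _ _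
      have h2 : 0 < c := lt_min (lt_min (by linarith) (by linarith)) (div_pos hη0 hD)
      rw [le_div_iff₀ hD] at h1
      nlinarith [mul_pos h2 hK0]
  set W : ℤ → ℝ := fun n => if 0 ≤ n then c * (ρ ^ (-n) + θ ^ (-n)) else 0 with hW
  have hle1 : ∀ n : ℤ, 0 ≤ n → ρ ^ (-n) ≤ 1 ∧ θ ^ (-n) ≤ ρ ^ (-n) := by
    intro n hn
    refine ⟨zpow_le_one_of_nonpos₀ h.one_lt_rho.le (by omega), ?_⟩
    rw [zpow_neg, zpow_neg]
    exact inv_anti₀ (zpow_pos hρ0 n) (zpow_le_zpow_left₀ hn hρ0.le hρθ)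
  have hW0 : ∀ n, 0 ≤ W n := fun n => by simp only [hW]; split_ifs <;> positivity
  have hW2c : ∀ n, W n ≤ 2 * c * ρ ^ (-n) := by
    intro n
    simp only [hW]
    split_ifs with hn
    · nlinarith [(hle1 n hn).2]
    · positivity
  have hW2 : ∀ n, W n ≤ 2 * c := by
    intro n
    rcases le_or_gt 0 n with hn | hn
    · exact (hW2c n).trans (mul_le_of_le_one_right (by positivity) (hle1 n hn).1)
    · simp only [hW, if_neg hn.not_ge]; positivity
  have hWq : ∀ n, W n ≤ q := fun n => (hW2 n).trans hcq
  have hWlim : Tendsto W atTop (𝓝 0) :=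
    squeeze_zero hW0 hW2c (by simpa using h.tendsto_rho_neg.const_mul (2 * c))
  have hWM : ∀ n < M, W n ≤ w n := by
    intro n hn
    rcases le_or_gt 0 n with h0 | h0
    · exact (hW2 n).trans (hcw.trans (hmin n (Finset.mem_Icc.2 ⟨h0, hn.le⟩)))
    · simp only [hW, if_neg h0.not_ge]; exact h.nonneg n
  -- Where `W` is cut, both exponentials are at most `θ ^ (y - n)`, so subtracting `2 * c` times it
  -- makes the left side nonpositive.
  have hWlow : ∀ n y : ℤ, c * (ρ ^ (-n) * ρ ^ y + θ ^ (-n) * θ ^ y) -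
      2 * c * (θ ^ (-n) * θ ^ y) * (if n < y then 1 else 0) ≤ W (n - y) := by
    intro n y
    rw [← zpow_add₀ hρ0.ne', ← zpow_add₀ hθ0.ne', neg_add_eq_sub]
    simp only [hW]
    rcases lt_or_ge n y with hny | hny
    · rw [if_pos hny, if_neg (by omega)]
      have : ρ ^ (y - n) ≤ θ ^ (y - n) := zpow_le_zpow_left₀ (by omega) hρ0.le hρθ
      nlinarith
    · rw [if_neg hny.not_gt, if_pos (by omega), neg_sub]
      linarith
  have hWsq : ∀ n y : ℤ, W (n - y) ^ 2 ≤ 4 * c ^ 2 * (θ ^ (-n) * θ ^ y) := by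
    intro n y
    have h1 : W (n - y) ^ 2 ≤ (2 * c * ρ ^ (-(n - y))) ^ 2 :=
      pow_le_pow_left₀ (hW0 _) (hW2c _) 2
    have h2 : (ρ ^ (-(n - y))) ^ 2 = θ ^ (-n) * θ ^ y := by
      rw [← zpow_add₀ hθ0.ne', hθ, ← zpow_natCast, ← zpow_natCast, ← zpow_mul, ← zpow_mul]
      congr 1
      push_cast; ring
    calc W (n - y) ^ 2 ≤ (2 * c * ρ ^ (-(n - y))) ^ 2 := h1
      _ = 4 * c ^ 2 * (ρ ^ (-(n - y))) ^ 2 := by ring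
      _ = _ := by rw [h2]
  have hWsub : ∀ n, M ≤ n → W n ≤ ∑' y : ℤ, (a y).toReal * g (W (n - y)) := by
    intro n hn
    have hn0 : 0 ≤ n := by omega
    set T := ∑' y : ℤ, (a y).toReal * θ ^ y * (if n < y then 1 else 0) with hTdef
    have hTn : 2 * m * T ≤ η := hM₀ n ((le_max_left _ _).trans hn)
    have hlow := (((h.hasSum_rho.mul_left (m * c * ρ ^ (-n))).add
      (h.summable_sq.hasSum.mul_left (m * c * θ ^ (-n)))).sub
      ((hsT n).hasSum.mul_left (2 * m * c * θ ^ (-n)))).sub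
      (h.summable_sq.hasSum.mul_left (4 * c ^ 2 * C * θ ^ (-n)))
    have h1 := hasSum_le (fun y => ?_) hlow (h.summable_g hW0 hWq n).hasSum
    · refine le_trans ?_ h1
      change _ ≤ m * c * ρ ^ (-n) * m⁻¹ + m * c * θ ^ (-n) * K - 2 * m * c * θ ^ (-n) * T -
        4 * c ^ 2 * C * θ ^ (-n) * K
      simp only [hW, if_pos hn0]
      have e : m * c * ρ ^ (-n) * m⁻¹ = c * ρ ^ (-n) := by
        have := h.m_pos.ne'; field_simp
      rw [e]
      have hcθ : 0 < c * θ ^ (-n) := by positivity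
      have : 1 ≤ m * K - 2 * m * T - 4 * c * C * K := by linarith [hη]
      nlinarith [mul_le_mul_of_nonneg_left this hcθ.le]
    · have h2 := h.le_g _ (hW0 (n - y)) (hWq (n - y))
      have h3 := mul_le_mul_of_nonneg_left (hWlow n y) h.m_pos.le
      have h4 := mul_le_mul_of_nonneg_left (hWsq n y) h.C_nonneg
      have h5 := mul_le_mul_of_nonneg_left (h2.trans' (sub_le_sub h3 h4))
        (ENNReal.toReal_nonneg (a := a y))
      refine le_trans (le_of_eq ?_) h5
      ring
  refine ⟨c, hc, fun n => ?_⟩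
  have h1 := h.subsolution_le hM hW0 hWq hWlim hWM hWsub n
  have h2 : c * ρ ^ (-(n : ℤ)) ≤ W n := by
    simp only [hW, if_pos (Int.natCast_nonneg n)]
    have : 0 < θ ^ (-(n : ℤ)) := by positivity
    nlinarith
  have h3 := mul_le_mul_of_nonneg_left (h2.trans h1) (pow_pos hρ0 n).le
  rw [zpow_neg, zpow_natCast, mul_left_comm, mul_inv_cancel₀ (pow_pos hρ0 n).ne', mul_one] at h3
  exact h3

end SubcriticalRecursion

/-! ### A renewal theorem for subharmonic functions -/

/-- A bounded-above harmonic function of an irreducible walk that attains its maximum is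
constant. -/
lemma harmonic_eq_of_max {b : ℤ → ℝ} (hb0 : ∀ y, 0 ≤ b y) (hb : HasSum b 1) (hb1 : 0 < b 1)
    {z : ℤ} (hz : z < 0) (hbz : 0 < b z) {H : ℤ → ℝ}
    (hH : ∀ j, HasSum (fun y => b y * H (j - y)) (H j)) (hmax : ∀ j, H j ≤ H 0) (j : ℤ) :
    H j = H 0 := by
  -- At a maximum point the nonnegative gaps average to zero, so each gap of positive weight
  -- vanishes.
  have step : ∀ j, H j = H 0 → ∀ y, 0 < b y → H (j - y) = H 0 := by
    intro j hj y hy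
    have h0 : HasSum (fun y => b y * (H 0 - H (j - y))) 0 := by
      have := (hb.mul_right (H 0)).sub (hH j)
      rw [one_mul, hj, sub_self] at this
      simpa only [mul_sub] using this
    have := congrFun ((hasSum_zero_iff_of_nonneg fun y =>
      mul_nonneg (hb0 y) (sub_nonneg.2 (hmax _))).1 h0) y
    simp only [Pi.zero_apply, mul_eq_zero, hy.ne', false_or] at this
    linarith
  have hdown : ∀ j, H j = H 0 → ∀ k : ℕ, H (j - k) = H 0 := by
    intro j hj k
    induction k with
    | zero => simpa using hj
    | succ k ih =>
      have := step _ ih 1 hb1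
      rwa [show j - k - 1 = j - ((k + 1 : ℕ) : ℤ) by push_cast; ring] at this
  -- Negative jumps climb beyond any `j`; unit steps then descend to it exactly.
  have hup : ∀ k : ℕ, H (-(k * z)) = H 0 := by
    intro k
    induction k with
    | zero => simp
    | succ k ih =>
      have := step _ ih z hbz
      rwa [show -(k * z) - z = -(((k + 1 : ℕ) : ℤ) * z) by push_cast; ring] at this
  have hle : j ≤ -(j.toNat * z) := by
    have := Int.self_le_toNat j
    have : (0 : ℤ) ≤ j.toNat := Int.natCast_nonneg _
    nlinarith
  have := hdown _ (hup j.toNat) (-(j.toNat * z) - j).toNat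
  have e : ((-(j.toNat * z) - j).toNat : ℤ) = -(j.toNat * z) - j :=
    Int.toNat_of_nonneg (by linarith)
  rwa [e, sub_sub_cancel] at this

/-- Along an ultrafilter all shifts of a bounded sequence converge at once, so no diagonal
extraction is needed. -/
lemma exists_ultrafilter_of_frequently {h : ℕ → ℝ} {L : ℝ}
    (hf : ∀ ε > 0, ∃ᶠ n in atTop, |h n - L| < ε) :
    ∃ U : Ultrafilter ℕ, (U : Filter ℕ) ≤ atTop ∧ Tendsto h U (𝓝 L) := by
  have hc : MapClusterPt L atTop h := by
    rw [Metric.nhds_basis_ball.mapClusterPt_iff_frequently]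
    intro ε hε
    exact (hf ε hε).mono fun n hn => by rwa [Metric.mem_ball, Real.dist_eq]
  exact mapClusterPt_iff_ultrafilter.1 hc

/-- A renewal theorem: a bounded function on `ℤ` that is subharmonic on the positive integers for
an aperiodic walk with nonzero drift, with a defect vanishing at infinity, converges. -/
lemma exists_tendsto_of_subharmonic {b : ℤ → ℝ} (hb0 : ∀ y, 0 ≤ b y) (hb : HasSum b 1)
    (hb1 : 0 < b 1) {z : ℤ} (hz : z < 0) (hbz : 0 < b z)
    (hbabs : Summable fun y : ℤ => b y * |(y : ℝ)|)
    (hdrift : ∑' y : ℤ, b y * (y : ℝ) ≠ 0) {h : ℤ → ℝ} {q : ℝ} (hh0 : ∀ n, 0 ≤ h n)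
    (hhq : ∀ n, h n ≤ q) (hsum : ∀ n, Summable fun j : ℕ => h (n - j))
    (hsub : ∀ n, 0 < n → h n ≤ ∑' y : ℤ, b y * h (n - y))
    (hdefect : Tendsto (fun n => ∑' y : ℤ, b y * h (n - y) - h n) atTop (𝓝 0)) :
    ∃ κ, Tendsto (fun n : ℕ => h n) atTop (𝓝 κ) := by
  have habs : ∀ n, |h n| ≤ q := fun n => by rw [abs_of_nonneg (hh0 n)]; exact hhq n
  have hsh : ∀ n, Summable fun y : ℤ => b y * h (n - y) := fun n =>
    (hb.summable.mul_right q).of_nonneg_of_le (fun y => mul_nonneg (hb0 y) (hh0 _))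
      fun y => mul_le_mul_of_nonneg_left (hhq _) (hb0 y)
  set S : ℤ → ℝ := fun n => ∑' j : ℕ, h (n - j) with hS
  have hSstep : ∀ n, S n = h n + S (n - 1) := by
    intro n
    simp only [hS]
    rw [(hsum n).tsum_eq_zero_add]
    simp only [Nat.cast_zero, sub_zero]
    congr 1
    refine tsum_congr fun j => ?_
    rw [show n - ((j + 1 : ℕ) : ℤ) = n - 1 - j by push_cast; ring]
  have hup : ∀ n y, S n - S (n - (y + 1)) = (S n - S (n - y)) + h (n - y) := by
    intro n y
    have := hSstep (n - y)
    rw [show n - y - 1 = n - (y + 1) by ring] at this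
    linarith
  have hSb : ∀ n y : ℤ, |S n - S (n - y)| ≤ q * |(y : ℝ)| := by
    intro n y
    induction y using Int.induction_on with
    | zero => simp
    | succ i ih =>
      rw [hup]
      have h1 := abs_add_le (S n - S (n - i)) (h (n - i))
      have h2 := habs (n - i)
      have e1 : |((i : ℤ) : ℝ)| = i := by simp
      have e2 : |(((i : ℤ) + 1 : ℤ) : ℝ)| = i + 1 := by
        rw [abs_of_nonneg (by positivity)]; push_cast; ring
      rw [e1] at ih
      rw [e2]
      linarith
    | pred i ih =>
      have h0 := hup n (-(i : ℤ) - 1)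
      rw [sub_add_cancel] at h0
      have h1 : S n - S (n - (-(i : ℤ) - 1)) =
          (S n - S (n - -(i : ℤ))) - h (n - (-(i : ℤ) - 1)) := by linarith
      have h2 := abs_sub (S n - S (n - -(i : ℤ))) (h (n - (-(i : ℤ) - 1)))
      have h3 := habs (n - (-(i : ℤ) - 1))
      rw [h1]
      have e1 : |((-(i : ℤ) : ℤ) : ℝ)| = i := by simp
      have e2 : |((-(i : ℤ) - 1 : ℤ) : ℝ)| = i + 1 := by
        rw [← abs_neg, abs_of_nonneg (by push_cast; linarith [Nat.cast_nonneg (α := ℝ) i])]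
        push_cast; ring
      rw [e1] at ih
      rw [e2]
      linarith
  -- The flux of `h` through level `n`. Its increment is minus the defect, so it decreases along the
  -- positive integers; being bounded, it converges.
  set F : ℤ → ℝ := fun n => ∑' y : ℤ, b y * (S n - S (n - y)) with hF
  have hbb : ∀ n y : ℤ, ‖b y * (S n - S (n - y))‖ ≤ q * (b y * |(y : ℝ)|) := fun n y => by
    rw [norm_mul, Real.norm_of_nonneg (hb0 y), mul_left_comm]
    exact mul_le_mul_of_nonneg_left (hSb n y) (hb0 y)
  have hFs : ∀ n, Summable fun y : ℤ => b y * (S n - S (n - y)) := fun n =>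
    (hbabs.mul_left q).of_norm_bounded (hbb n)
  have hFb : ∀ n, |F n| ≤ q * ∑' y : ℤ, b y * |(y : ℝ)| := fun n =>
    tsum_of_norm_bounded (hbabs.hasSum.mul_left q) (hbb n)
  have hFstep : ∀ n, F n - F (n - 1) = h n - ∑' y : ℤ, b y * h (n - y) := by
    intro n
    have h1 := (hb.mul_right (h n)).sub (hsh n).hasSum
    rw [one_mul] at h1
    rw [← h1.tsum_eq]
    simp only [hF]
    rw [← (hFs n).tsum_sub (hFs (n - 1))]
    refine tsum_congr fun y => ?_
    have e1 := hSstep n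
    have e2 := hSstep (n - y)
    rw [show n - y - 1 = n - 1 - y by ring] at e2
    rw [e1, e2]; ring
  obtain ⟨Φ, hΦ⟩ : ∃ Φ, Tendsto (fun n : ℕ => F n) atTop (𝓝 Φ) := by
    have hanti : Antitone fun n : ℕ => F n := antitone_nat_of_succ_le fun n => by
      have h1 := hFstep ((n + 1 : ℕ) : ℤ)
      have h2 := hsub ((n + 1 : ℕ) : ℤ) (by positivity)
      rw [show ((n + 1 : ℕ) : ℤ) - 1 = n by push_cast; ring] at h1
      linarith
    exact ⟨_, tendsto_atTop_ciInf hanti ⟨-(q * ∑' y : ℤ, b y * |(y : ℝ)|), by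
      rintro _ ⟨n, rfl⟩; exact (abs_le.1 (hFb n)).1⟩⟩
  have hcast : ∀ j : ℤ, Tendsto (fun n : ℕ => (n : ℤ) + j) atTop atTop := fun j =>
    tendsto_atTop_add_const_right _ j tendsto_natCast_atTop_atTop
  -- The defect vanishes at infinity, so every limit profile is harmonic on all of `ℤ`.
  have hlimit : ∀ U : Ultrafilter ℕ, (U : Filter ℕ) ≤ atTop →
      ∃ H : ℤ → ℝ, (∀ j, Tendsto (fun n : ℕ => h (n + j)) U (𝓝 (H j))) ∧
        ∀ j, HasSum (fun y => b y * H (j - y)) (H j) := by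
    intro U hU
    have hex : ∀ j : ℤ, ∃ x ∈ Set.Icc 0 q, Tendsto (fun n : ℕ => h (n + j)) U (𝓝 x) := by
      intro j
      have := isCompact_iff_ultrafilter_le_nhds.1 (isCompact_Icc (a := (0 : ℝ)) (b := q))
        (U.map fun n : ℕ => h (n + j)) (by
          rw [Ultrafilter.coe_map, le_principal_iff]
          exact Filter.mem_map.2 (Filter.univ_mem' fun n =>
            (⟨hh0 _, hhq _⟩ : h (n + j) ∈ Set.Icc 0 q)))
      exact this
    choose H hHmem hH using hex
    refine ⟨H, hH, fun j => ?_⟩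
    have h1 : Tendsto (fun n : ℕ => ∑' y : ℤ, b y * h (n + j - y)) U
        (𝓝 (∑' y : ℤ, b y * H (j - y))) := by
      refine tendsto_tsum_of_dominated_convergence (hb.summable.mul_right q) (fun y => ?_)
        (.of_forall fun n y => ?_)
      · refine Tendsto.const_mul _ ((hH (j - y)).congr fun n => ?_)
        rw [add_sub_assoc]
      · rw [norm_mul, Real.norm_of_nonneg (hb0 y)]
        exact mul_le_mul_of_nonneg_left (habs _) (hb0 y)
    have h2 := (hdefect.comp (hcast j)).mono_left hU
    have h3 : ∑' y : ℤ, b y * H (j - y) - H j = 0 :=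
      tendsto_nhds_unique (h1.sub (hH j)) h2
    rw [← sub_eq_zero.1 h3]
    exact ((hb.summable.mul_right q).of_nonneg_of_le
      (fun y => mul_nonneg (hb0 y) (hHmem _).1)
      fun y => mul_le_mul_of_nonneg_left (hHmem _).2 (hb0 y)).hasSum
  -- A constant profile `L` has flux `L` times the drift. As the flux converges and the drift is
  -- nonzero, `L` is determined.
  have hflux : ∀ U : Ultrafilter ℕ, (U : Filter ℕ) ≤ atTop → ∀ L,
      (∀ j : ℤ, Tendsto (fun n : ℕ => h (n + j)) U (𝓝 L)) →
      L = Φ / ∑' y : ℤ, b y * (y : ℝ) := by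
    intro U hU L hL
    have hterm : ∀ y : ℤ, Tendsto (fun n : ℕ => S n - S (n - y)) U (𝓝 (y * L)) := by
      intro y
      induction y using Int.induction_on with
      | zero => simp
      | succ i ih =>
        simp_rw [hup]
        have := ih.add (hL (-(i : ℤ)))
        simp only [← sub_eq_add_neg] at this
        convert this using 2
        push_cast; ring
      | pred i ih =>
        have h1 : ∀ n : ℕ, S n - S (n - (-(i : ℤ) - 1)) =
            (S n - S (n - -(i : ℤ))) - h (n + (i + 1)) := by
          intro n
          have h0 := hup n (-(i : ℤ) - 1)
          rw [sub_add_cancel, show (n : ℤ) - (-(i : ℤ) - 1) = n + (i + 1) by ring] at h0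
          rw [show (n : ℤ) - (-(i : ℤ) - 1) = n + (i + 1) by ring]
          linarith
        simp_rw [h1]
        convert ih.sub (hL (i + 1)) using 2
        push_cast; ring
    have h1 : Tendsto (fun n : ℕ => F n) U (𝓝 (∑' y : ℤ, b y * (y * L))) :=
      tendsto_tsum_of_dominated_convergence (hbabs.mul_left q)
        (fun y => (hterm y).const_mul _) (.of_forall fun n y => hbb n y)
    have h2 := tendsto_nhds_unique h1 (hΦ.mono_left hU)
    simp_rw [← mul_assoc] at h2
    rw [tsum_mul_right] at h2
    rw [eq_div_iff hdrift, mul_comm, h2]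
  have hbddA : IsBoundedUnder (· ≤ ·) atTop fun n : ℕ => h n := isBoundedUnder_of ⟨q, fun n => hhq n⟩
  have hbddB : IsBoundedUnder (· ≥ ·) atTop fun n : ℕ => h n := isBoundedUnder_of ⟨0, fun n => hh0 n⟩
  have hshift : ∀ (j : ℤ) {Q : ℝ → Prop}, (∀ᶠ n : ℕ in atTop, Q (h n)) →
      ∀ᶠ n : ℕ in atTop, Q (h (n + j)) := by
    intro j Q hQ
    obtain ⟨M, hM⟩ := eventually_atTop.1 hQ
    filter_upwards [(hcast j).eventually_ge_atTop (M : ℤ)] with n hn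
    have := hM ((n : ℤ) + j).toNat (by omega)
    rwa [Int.toNat_of_nonneg (by omega)] at this
  have hsup : limsup (fun n : ℕ => h n) atTop = Φ / ∑' y : ℤ, b y * (y : ℝ) := by
    set L := limsup (fun n : ℕ => h n) atTop with hLdef
    have hle : ∀ ε > 0, ∀ᶠ n : ℕ in atTop, h n < L + ε := fun ε hε =>
      eventually_lt_of_limsup_lt (by rw [← hLdef]; linarith) hbddA
    obtain ⟨U, hU, hUL⟩ := exists_ultrafilter_of_frequently (h := fun n : ℕ => h n) (L := L)
      fun ε hε => ((frequently_lt_of_lt_limsup hbddB.isCoboundedUnder_le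
        (by rw [← hLdef]; linarith : L - ε < limsup (fun n : ℕ => h n) atTop)).and_eventually
          (hle ε hε)).mono fun n hn => abs_lt.2 ⟨by linarith [hn.1], by linarith [hn.2]⟩
    obtain ⟨H, hH, hHarm⟩ := hlimit U hU
    have hH0 : H 0 = L := tendsto_nhds_unique (by simpa using hH 0) hUL
    -- `U` realises the limsup at shift `0` and no shift can exceed it, so the maximum principle
    -- makes the profile constant.
    have hmax : ∀ j, H j ≤ H 0 := by
      intro j
      rw [hH0]
      refine le_of_forall_pos_le_add fun ε hε => le_of_tendsto (hH j) ?_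
      exact ((hshift j (Q := fun x => x < L + ε) (hle ε hε)).filter_mono hU).mono fun n hn => hn.le
    refine hflux U hU L fun j => ?_
    rw [← hH0, ← harmonic_eq_of_max hb0 hb hb1 hz hbz hHarm hmax j]
    exact hH j
  have hinf : liminf (fun n : ℕ => h n) atTop = Φ / ∑' y : ℤ, b y * (y : ℝ) := by
    set L := liminf (fun n : ℕ => h n) atTop with hLdef
    have hge : ∀ ε > 0, ∀ᶠ n : ℕ in atTop, L - ε < h n := fun ε hε =>
      eventually_lt_of_lt_liminf (by rw [← hLdef]; linarith) hbddB
    obtain ⟨U, hU, hUL⟩ := exists_ultrafilter_of_frequently (h := fun n : ℕ => h n) (L := L)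
      fun ε hε => ((frequently_lt_of_liminf_lt hbddA.isCoboundedUnder_ge
        (by rw [← hLdef]; linarith : liminf (fun n : ℕ => h n) atTop < L + ε)).and_eventually
          (hge ε hε)).mono fun n hn => abs_lt.2 ⟨by linarith [hn.2], by linarith [hn.1]⟩
    obtain ⟨H, hH, hHarm⟩ := hlimit U hU
    have hH0 : H 0 = L := tendsto_nhds_unique (by simpa using hH 0) hUL
    have hmin : ∀ j, -H j ≤ -H 0 := by
      intro j
      rw [hH0, neg_le_neg_iff]
      refine le_of_forall_pos_sub_le fun ε hε => ge_of_tendsto (hH j) ?_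
      exact ((hshift j (Q := fun x => L - ε < x) (hge ε hε)).filter_mono hU).mono fun n hn => hn.le
    refine hflux U hU L fun j => ?_
    have := harmonic_eq_of_max hb0 hb hb1 hz hbz (H := fun j => -H j)
      (fun j => by simpa only [mul_neg] using (hHarm j).neg) hmin j
    rw [← hH0, ← neg_inj.1 this]
    exact hH j
  exact ⟨_, tendsto_of_liminf_eq_limsup hinf hsup hbddA hbddB⟩

/-! ### Convergence of the rescaled solution -/

namespace SubcriticalRecursion

variable {a : PMF ℤ} {g : ℝ → ℝ} {q m C ρ : ℝ} {w : ℤ → ℝ}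
  (h : SubcriticalRecursion a g q m C ρ w)
include h

lemma scaled_le (n : ℤ) : ρ ^ n * w n ≤ q := by
  have h1 := mul_le_mul_of_nonneg_left (h.le_rho n) (zpow_pos h.rho_pos n).le
  rwa [mul_left_comm, ← zpow_add₀ h.rho_pos.ne', add_neg_cancel, zpow_zero, mul_one] at h1

/-- Tilting by `ρ ^ y` turns the linearised recursion into averaging: `b` has mass one because `m *
K ρ = 1`, and the tilt raises the mean from zero to a positive drift. -/
lemma exists_tendsto (ha_mean : HasSum (fun y : ℤ => (a y).toReal * (y : ℝ)) 0)
    {z : ℤ} (hz : z < 0) (haz : 0 < (a z).toReal) (ha1 : 0 < (a 1).toReal) :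
    ∃ κ, Tendsto (fun n : ℕ => ρ ^ n * w n) atTop (𝓝 κ) := by
  have hρ0 := h.rho_pos
  have hρ1 := h.one_lt_rho
  have hm := h.m_pos
  set θ : ℝ := ρ ^ 2 with hθ
  have hθ0 : 0 < θ := by positivity
  set b : ℤ → ℝ := fun y => m * ((a y).toReal * ρ ^ y) with hb
  set H : ℤ → ℝ := fun n => ρ ^ n * w n with hH
  have hb0 : ∀ y, 0 ≤ b y := fun y => by simp only [hb]; positivity
  have hbpos : ∀ y, 0 < (a y).toReal → 0 < b y := fun y hy => by simp only [hb]; positivity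
  have hbs : HasSum b 1 := by
    have := h.hasSum_rho.mul_left m
    rwa [mul_inv_cancel₀ hm.ne'] at this
  have hbabs : Summable fun y : ℤ => b y * |(y : ℝ)| := by
    have h1 : Summable fun y : ℤ => (a y).toReal * |(y : ℝ)| :=
      ha_mean.summable.abs.congr fun y => by rw [abs_mul, abs_of_nonneg ENNReal.toReal_nonneg]
    refine ((((h.summable_sq.mul_right (ρ - 1)⁻¹).add h1).mul_left m)).of_nonneg_of_le
      (fun y => mul_nonneg (hb0 y) (abs_nonneg _)) fun y => ?_
    have key : ρ ^ y * |(y : ℝ)| ≤ θ ^ y * (ρ - 1)⁻¹ + |(y : ℝ)| := by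
      rcases le_total 0 y with hy | hy
      · have h2 := mul_sub_le_zpow_sub le_rfl hρ1.le y
        have h3 : (0 : ℝ) ≤ y := by exact_mod_cast hy
        rw [one_zpow] at h2
        have h4 : (y : ℝ) ≤ ρ ^ y * (ρ - 1)⁻¹ := by
          rw [← div_eq_mul_inv, le_div_iff₀ (by linarith)]; linarith
        have h5 : θ ^ y = ρ ^ y * ρ ^ y := by
          rw [hθ, sq, mul_zpow]
        rw [abs_of_nonneg h3, h5, mul_assoc]
        have := mul_le_mul_of_nonneg_left h4 (zpow_pos hρ0 y).le
        linarith
      · have h2 : ρ ^ y ≤ 1 := zpow_le_one_of_nonpos₀ hρ1.le hy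
        have h3 : 0 ≤ θ ^ y * (ρ - 1)⁻¹ := mul_nonneg (by positivity) (inv_nonneg.2 (by linarith))
        have := mul_le_of_le_one_left (abs_nonneg (y : ℝ)) h2
        linarith
    have := mul_le_mul_of_nonneg_left key (mul_nonneg hm.le (ENNReal.toReal_nonneg (a := a y)))
    simp only [hb]
    linarith
  have hbmean : Summable fun y : ℤ => b y * (y : ℝ) :=
    hbabs.of_norm_bounded fun y => by
      rw [norm_mul, Real.norm_of_nonneg (hb0 y), Real.norm_eq_abs]
  have hdrift : 0 < ∑' y : ℤ, b y * (y : ℝ) := by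
    have h0 := ha_mean.mul_left m
    rw [mul_zero] at h0
    rw [← h0.tsum_eq]
    refine Summable.tsum_lt_tsum (i := 1) (fun y => ?_) ?_ h0.summable hbmean
    · have key : (y : ℝ) ≤ ρ ^ y * y := by
        rcases le_total 0 y with hy | hy
        · have h3 : (0 : ℝ) ≤ y := by exact_mod_cast hy
          exact le_mul_of_one_le_left h3 (one_le_zpow₀ hρ1.le hy)
        · have h2 : ρ ^ y ≤ 1 := zpow_le_one_of_nonpos₀ hρ1.le hy
          have h3 : (y : ℝ) ≤ 0 := by exact_mod_cast hy
          nlinarith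
      have := mul_le_mul_of_nonneg_left key (mul_nonneg hm.le (ENNReal.toReal_nonneg (a := a y)))
      simp only [hb]
      linarith
    · simp only [hb, Int.cast_one, zpow_one, mul_one]
      exact mul_lt_mul_of_pos_left (lt_mul_of_one_lt_right ha1 hρ1) hm
  have hsum : ∀ n, Summable fun j : ℕ => H (n - j) := by
    intro n
    refine ((summable_geometric_of_lt_one (inv_nonneg.2 hρ0.le)
      (inv_lt_one_of_one_lt₀ hρ1)).mul_left (q * ρ ^ n)).of_nonneg_of_le
      (fun j => mul_nonneg (by positivity) (h.nonneg _)) fun j => ?_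
    have h1 := mul_le_mul_of_nonneg_left (h.le_q (n - j)) (zpow_pos hρ0 (n - j)).le
    refine h1.trans_eq ?_
    rw [zpow_sub₀ hρ0.ne', zpow_natCast, inv_pow]
    field_simp
  have hws : ∀ n, Summable fun y : ℤ => (a y).toReal * w (n - y) := fun n =>
    summable_mul_of_bounded (C := q) fun y => by rw [abs_of_nonneg (h.nonneg _)]; exact h.le_q _
  have hbH : ∀ n, ∑' y : ℤ, b y * H (n - y) = ρ ^ n * ∑' y : ℤ, (a y).toReal * (m * w (n - y)) := by
    intro n
    rw [← tsum_mul_left]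
    refine tsum_congr fun y => ?_
    simp only [hb, hH]
    rw [zpow_sub₀ hρ0.ne']
    have := (zpow_pos hρ0 y).ne'
    field_simp
  have hmws : ∀ n, Summable fun y : ℤ => (a y).toReal * (m * w (n - y)) := fun n =>
    ((hws n).mul_left m).congr fun y => by ring
  have hgs : ∀ n, Summable fun y : ℤ => (a y).toReal * g (w (n - y)) :=
    h.summable_g h.nonneg h.le_q
  have hsub : ∀ n, 0 < n → H n ≤ ∑' y : ℤ, b y * H (n - y) := by
    intro n hn
    rw [hbH]
    refine mul_le_mul_of_nonneg_left ?_ (zpow_pos hρ0 n).le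
    rw [h.recursion n hn]
    exact (hgs n).tsum_le_tsum (fun y => mul_le_mul_of_nonneg_left
      (h.g_le _ (h.nonneg _) (h.le_q _)) ENNReal.toReal_nonneg) (hmws n)
  set K := ∑' y : ℤ, (a y).toReal * θ ^ y with hK
  -- The defect is quadratic in `w`, hence of order `ρ ^ (-2n)`; rescaling by `ρ ^ n` leaves a null
  -- sequence.
  have hdef : ∀ n, 0 < n → ∑' y : ℤ, b y * H (n - y) - H n ≤ C * q ^ 2 * K * ρ ^ (-n) := by
    intro n hn
    rw [hbH]
    simp only [hH]
    rw [h.recursion n hn, ← mul_sub, ← (hmws n).tsum_sub (hgs n)]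
    have hle : ∑' y : ℤ, ((a y).toReal * (m * w (n - y)) - (a y).toReal * g (w (n - y))) ≤
        ∑' y : ℤ, C * q ^ 2 * θ ^ (-n) * ((a y).toReal * θ ^ y) := by
      refine ((hmws n).sub (hgs n)).tsum_le_tsum (fun y => ?_) (h.summable_sq.mul_left _)
      have h1 := h.le_g _ (h.nonneg (n - y)) (h.le_q (n - y))
      have h2 : w (n - y) ^ 2 ≤ q ^ 2 * (θ ^ (-n) * θ ^ y) := by
        have h3 := pow_le_pow_left₀ (h.nonneg _) (h.le_rho (n - y)) 2
        refine h3.trans_eq ?_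
        rw [mul_pow, ← zpow_add₀ hθ0.ne', hθ, ← zpow_natCast (ρ ^ (-(n - y))),
          ← zpow_natCast ρ, ← zpow_mul, ← zpow_mul]
        congr 2
        push_cast; ring
      have h4 := mul_le_mul_of_nonneg_left h2 h.C_nonneg
      have h5 := mul_le_mul_of_nonneg_left
        (by linarith : m * w (n - y) - g (w (n - y)) ≤ C * (q ^ 2 * (θ ^ (-n) * θ ^ y)))
        (ENNReal.toReal_nonneg (a := a y))
      linarith
    rw [tsum_mul_left] at hle
    refine (mul_le_mul_of_nonneg_left hle (zpow_pos hρ0 n).le).trans_eq ?_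
    have e : ρ ^ n * θ ^ (-n) = ρ ^ (-n) := by
      rw [hθ, sq, mul_zpow, ← mul_assoc, ← zpow_add₀ hρ0.ne', add_neg_cancel, zpow_zero, one_mul]
    rw [← e]; ring
  have hdefect : Tendsto (fun n => ∑' y : ℤ, b y * H (n - y) - H n) atTop (𝓝 0) := by
    have hlim : Tendsto (fun n : ℤ => C * q ^ 2 * K * ρ ^ (-n)) atTop (𝓝 0) := by
      simpa using h.tendsto_rho_neg.const_mul (C * q ^ 2 * K)
    refine tendsto_of_tendsto_of_tendsto_of_le_of_le' tendsto_const_nhds hlim ?_ ?_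
    · filter_upwards [eventually_gt_atTop 0] with n hn
      exact sub_nonneg.2 (hsub n hn)
    · filter_upwards [eventually_gt_atTop 0] with n hn
      exact hdef n hn
  obtain ⟨κ, hκ⟩ := exists_tendsto_of_subharmonic hb0 hbs (hbpos 1 ha1) hz (hbpos z haz) hbabs
    hdrift.ne' (fun n => mul_nonneg (zpow_pos hρ0 n).le (h.nonneg n)) h.scaled_le hsum hsub hdefect
  exact ⟨κ, by simpa only [hH, zpow_natCast] using hκ⟩

end SubcriticalRecursion

/-! ### The tail probability solves the subcritical recursion -/

lemma offspringPGF_strictMono {p : PMF ℕ} (h2 : Summable fun k : ℕ => (p k).toReal * (k : ℝ) ^ 2)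
    (hmean : 1 < ∑' k : ℕ, (p k).toReal * (k : ℝ)) {s t : ℝ} (hs : 0 ≤ s) (hst : s < t)
    (ht : t ≤ 1) : offspringPGF p s < offspringPGF p t := by
  obtain ⟨k, hk, hpk⟩ := exists_two_le_offspring h2 hmean
  exact Summable.tsum_lt_tsum (i := k) (fun j => by gcongr)
    (mul_lt_mul_of_pos_left (pow_lt_pow_left₀ hst hs (by omega)) hpk)
    (summable_pgf hs (hst.le.trans ht)) (summable_pgf (hs.trans hst.le) ht)

section recursion

variable {p : PMF ℕ} {a : PMF ℤ} {q ρ : ℝ}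

lemma summable_offspringPGF_comp {v : ℤ → ℝ} (hv0 : ∀ n, 0 ≤ v n) (hv1 : ∀ n, v n ≤ 1) (n : ℤ) :
    Summable fun y : ℤ => (a y).toReal * offspringPGF p (v (n - y)) :=
  summable_mul_of_bounded (C := 1) fun y => by
    rw [abs_of_nonneg (offspringPGF_nonneg (hv0 _))]
    exact offspringPGF_le_one (hv0 _) (hv1 _)

/-- Truncating at generation `k` allows an induction: for `k = 0` and `n > 0` the left side is `-(1
- q)`. The step uses the tangent at `q` and that `q * ρ ^ (-n)` solves the linearised recursion
exactly. -/
lemma reachProb_sub_le (h2 : Summable fun k : ℕ => (p k).toReal * (k : ℝ) ^ 2)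
    (hq0 : 0 < q) (hq1 : q < 1) (hfix : offspringPGF p q = q) (hm : 0 < offspringPGFDeriv p q)
    (hρ : 1 < ρ) (hsum : HasSum (fun y : ℤ => (a y).toReal * ρ ^ y) (offspringPGFDeriv p q)⁻¹)
    (k : ℕ) : ∀ n : ℤ, reachProb p a (· ≤ k) n - (1 - q) ≤ q * ρ ^ (-n) := by
  have hρ0 : 0 < ρ := by linarith
  have hnonpos : ∀ (k : ℕ) (n : ℤ), n ≤ 0 →
      reachProb p a (· ≤ k) n - (1 - q) ≤ q * ρ ^ (-n) := by
    intro k n hn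
    rw [reachProb_of_nonpos p a _ (Nat.zero_le k) hn]
    have := one_le_zpow₀ hρ.le (show 0 ≤ -n by omega)
    nlinarith
  induction k with
  | zero =>
    intro n
    rcases le_or_gt n 0 with hn | hn
    · exact hnonpos 0 n hn
    · rw [reachProb_zero_generations p a hn]
      have : 0 < q * ρ ^ (-n) := by positivity
      linarith
  | succ k ih =>
    intro n
    rcases le_or_gt n 0 with hn | hn
    · exact hnonpos (k + 1) n hn
    · have hrec := reachProb_eq_branching p a (· ≤ k + 1) hn
      simp only [Nat.add_le_add_iff_right] at hrec
      set m := offspringPGFDeriv p q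
      have hlow := ((hasSum_toReal a).mul_right q).sub (hsum.mul_left (m * q * ρ ^ (-n)))
      have hle := hasSum_le (fun y => ?_) hlow (summable_offspringPGF_comp (p := p) (a := a)
        (v := fun n => 1 - reachProb p a (· ≤ k) n)
        (fun n => sub_nonneg.2 (reachProb_le_one p a _ n))
        (fun n => sub_le_self _ (reachProb_nonneg p a _ n)) n).hasSum
      · rw [hrec]
        have e : m * q * ρ ^ (-n) * m⁻¹ = q * ρ ^ (-n) := by
          have := hm.ne'; field_simp
        rw [e] at hle
        linarith
      · have ht := tangent_le_offspringPGF h2 (s := 1 - reachProb p a (· ≤ k) (n - y))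
          (sub_nonneg.2 (reachProb_le_one p a _ _)) (sub_le_self _ (reachProb_nonneg p a _ _))
          hq0.le hq1.le
        rw [hfix] at ht
        have h3 := mul_le_mul_of_nonneg_left (ih (n - y)) hm.le
        rw [show -(n - y) = -n + y by ring, zpow_add₀ hρ0.ne'] at h3
        have h4 : q - m * (q * (ρ ^ (-n) * ρ ^ y)) ≤
            offspringPGF p (1 - reachProb p a (· ≤ k) (n - y)) := by
          linarith
        have h5 := mul_le_mul_of_nonneg_left h4 (ENNReal.toReal_nonneg (a := a y))
        linarith

lemma subcriticalRecursion (h2 : Summable fun k : ℕ => (p k).toReal * (k : ℝ) ^ 2)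
    (hmean : 1 < ∑' k : ℕ, (p k).toReal * (k : ℝ))
    (ha_mean : HasSum (fun y : ℤ => (a y).toReal * (y : ℝ)) 0) (ha_nondeg : a 0 ≠ 1)
    (ha_pgf : ∀ θ : ℝ, 1 ≤ θ → Summable fun y : ℤ => (a y).toReal * θ ^ y)
    (hq0 : 0 < q) (hq1 : q < 1) (hfix : offspringPGF p q = q)
    (hρ : 1 < ρ) (hK : jumpPGF a ρ = (offspringPGFDeriv p q)⁻¹) :
    SubcriticalRecursion a (fun s => q - offspringPGF p (q - s)) q (offspringPGFDeriv p q)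
      (∑' k : ℕ, (p k).toReal * (k : ℝ) ^ 2) ρ
      (fun n => reachProb p a (fun _ => True) n - (1 - q)) := by
  have hm := offspringPGFDeriv_pos h2 hmean hq0 hq1.le
  have hsum : HasSum (fun y : ℤ => (a y).toReal * ρ ^ y) (offspringPGFDeriv p q)⁻¹ := by
    rw [← hK]; exact (ha_pgf ρ hρ.le).hasSum
  have hsq : 1 < ρ ^ 2 := by nlinarith
  have hrec : ∀ n, 0 < n → reachProb p a (fun _ => True) n =
      1 - ∑' y : ℤ, (a y).toReal * offspringPGF p (1 - reachProb p a (fun _ => True) (n - y)) :=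
    fun n hn => reachProb_eq_branching p a (fun _ => True) hn
  refine
    { q_pos := hq0
      m_pos := hm
      m_lt_one := offspringPGFDeriv_lt_one h2 hmean hq0.le hq1 hfix
      C_nonneg := tsum_nonneg fun k => by positivity
      one_lt_rho := hρ
      hasSum_rho := hsum
      summable_sq := ha_pgf _ hsq.le
      one_lt_sq := ?_
      g_pos := fun s hs hsq => sub_pos.2 ?_
      g_mono := fun s t hs hst htq => sub_le_sub_left
        (offspringPGF_mono (by linarith) (by linarith) (by linarith)) _
      g_lip := fun s t hs hst htq => ?_
      g_le := fun s hs hsq => ?_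
      le_g := fun s hs hsq => ?_
      nonneg := fun n => sub_nonneg.2 ?_
      le_q := fun n => by linarith [reachProb_le_one p a (fun _ => True) n]
      le_rho := fun n => ?_
      of_nonpos := fun n hn => by
        rw [reachProb_of_nonpos p a _ trivial hn]; ring
      recursion := fun n hn => ?_
      pos_jump := exists_pos_jump ha_mean ha_nondeg }
  · have h3 := jumpPGF_lt ha_mean ha_nondeg ha_pgf hρ.le (by nlinarith : ρ < ρ ^ 2)
    rw [hK] at h3
    have := mul_lt_mul_of_pos_left h3 hm
    rwa [mul_inv_cancel₀ hm.ne'] at this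
  · calc offspringPGF p (q - s) < offspringPGF p q :=
          offspringPGF_strictMono h2 hmean (by linarith) (by linarith) hq1.le
      _ = q := hfix
  · have := offspringPGF_sub_le h2 (s := q - t) (t := q - s) (r := q) (by linarith) (by linarith)
      (by linarith) hq1.le
    linarith
  · have := tangent_le_offspringPGF h2 (s := q - s) (t := q) (by linarith) (by linarith)
      hq0.le hq1.le
    rw [hfix] at this
    linarith
  · have := offspringPGF_le_tangent_add_sq h2 (s := q - s) (t := q) (by linarith) (by linarith)
      hq0.le hq1.le
    rw [hfix, show q - s - q = -s by ring, neg_sq] at this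
    linarith
  · exact survival_le_of_recursion ha_mean h2 hmean ha_nondeg (reachProb_antitone p a _)
      (reachProb_nonneg p a _) (reachProb_le_one p a _)
      (fun n hn => reachProb_of_nonpos p a _ trivial hn) hrec hq0.le hfix n
  · exact le_of_tendsto' ((tendsto_reachProb p a n).sub_const (1 - q))
      fun k => reachProb_sub_le h2 hq0 hq1 hfix hm hρ hsum k n
  · have hs := summable_offspringPGF_comp (p := p) (a := a)
      (v := fun n => 1 - reachProb p a (fun _ => True) n)
      (fun n => sub_nonneg.2 (reachProb_le_one p a _ n))
      (fun n => sub_le_self _ (reachProb_nonneg p a _ n)) n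
    have h4 := ((hasSum_toReal a).mul_right q).sub hs.hasSum
    have h5 : ∑' y : ℤ, (a y).toReal *
        (q - offspringPGF p (q - (reachProb p a (fun _ => True) (n - y) - (1 - q)))) =
        1 * q - ∑' y : ℤ, (a y).toReal *
          offspringPGF p (1 - reachProb p a (fun _ => True) (n - y)) := by
      rw [← h4.tsum_eq]
      refine tsum_congr fun y => ?_
      rw [mul_sub]
      congr 3
      ring
    rw [h5, hrec n hn]
    ring

end recursion

end BRW

/-! ### The theorem -/

theorem proposition1
    -- offspring law: finite third moment, mean greater than one, childlessness possible
    (p : PMF ℕ)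
    (hp_third : Summable fun k : ℕ => (p k).toReal * (k : ℝ) ^ 3)
    (hp_mean : 1 < ∑' k : ℕ, (p k).toReal * (k : ℝ))
    (hp_zero : 0 < p 0)
    -- jump law: mean zero, finite variance, not a point mass, finite generating function
    (a : PMF ℤ)
    (ha_mean : HasSum (fun y : ℤ => (a y).toReal * (y : ℝ)) 0)
    (ha_var : Summable fun y : ℤ => (a y).toReal * (y : ℝ) ^ 2)
    (ha_nondeg : a 0 ≠ 1)
    (ha_pgf : ∀ θ : ℝ, 1 ≤ θ → Summable fun y : ℤ => (a y).toReal * θ ^ y)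
    -- a branching random walk with these laws
    {Ω : Type*} [MeasurableSpace Ω] (P : Measure Ω) [IsProbabilityMeasure P]
    (N : List ℕ → Ω → ℕ) (ξ : List ℕ → Ω → ℤ)
    (hX : BRW.IsBranchingRandomWalk P p a N ξ)
    -- the quantities in the claim
    (q : ℝ) (hq : q = BRW.extinctionProb P N)
    (γ : ℝ) (hγ : γ = (deriv (BRW.offspringPGF p) q)⁻¹)
    (l : ℕ → ℝ)
    (hl : ∀ n : ℕ, l n = BRW.rho a γ ^ n * (BRW.tailProb P N ξ (n : ℤ) - (1 - q))) :
    -- the base of the exponential is well defined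
    (∃! s : ℝ, 1 < s ∧ BRW.jumpPGF a s = γ) ∧
    -- (a)
    (0 < liminf (fun n : ℕ => (l n : EReal)) atTop ∧
      liminf (fun n : ℕ => (l n : EReal)) atTop ≤ limsup (fun n : ℕ => (l n : EReal)) atTop ∧
      limsup (fun n : ℕ => (l n : EReal)) atTop ≤ (q : EReal)) ∧
    -- (b)
    (∀ R : ℕ, BRW.HasRightRange a R → BRW.NearlyRightContinuous a R →
      ∃ κ : ℝ, 0 < κ ∧ κ ≤ q ∧ Tendsto l atTop (𝓝 κ)) := by
  have h2 : Summable fun k : ℕ => (p k).toReal * (k : ℝ) ^ 2 :=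
    hp_third.of_nonneg_of_le (fun k => by positivity) fun k => by
      gcongr ?_ * ?_
      rcases Nat.eq_zero_or_pos k with rfl | hk
      · simp
      · exact pow_le_pow_right₀ (by exact_mod_cast hk) (by norm_num)
  obtain ⟨hq0, hq1, hfix⟩ := BRW.extinction_fixedPoint h2 hp_mean hp_zero
    (BRW.emptyProb_zero p a) (BRW.emptyProb_succ p a) (hq ▸ hX.tendsto_emptyProb)
  have hm := BRW.offspringPGFDeriv_pos h2 hp_mean hq0 hq1.le
  have hm1 := BRW.offspringPGFDeriv_lt_one h2 hp_mean hq0.le hq1 hfix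
  rw [(BRW.hasDerivAt_offspringPGF h2 hq0 hq1).deriv] at hγ
  have hex := BRW.existsUnique_jumpPGF_eq ha_mean ha_nondeg ha_pgf
    (γ := γ) (hγ ▸ (one_lt_inv₀ hm).2 hm1)
  have hρ : 1 < BRW.rho a γ ∧ BRW.jumpPGF a (BRW.rho a γ) = γ :=
    Classical.epsilon_spec (p := fun s : ℝ => 1 < s ∧ BRW.jumpPGF a s = γ) hex.exists
  have hR := BRW.subcriticalRecursion h2 hp_mean ha_mean ha_nondeg ha_pgf hq0 hq1 hfix hρ.1
    (hρ.2.trans hγ)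
  have hl' : l = fun n : ℕ => BRW.rho a γ ^ n *
      (BRW.reachProb p a (fun _ => True) (n : ℤ) - (1 - q)) := by
    funext n
    rw [hl, hX.tailProb_eq]
  obtain ⟨c, hc, hcl⟩ := hR.exists_lower_bound
  have hlow : ∀ n, c ≤ l n := fun n => by rw [hl']; exact hcl n
  have hup : ∀ n, l n ≤ q := fun n => by
    rw [hl']
    simpa only [zpow_natCast] using hR.scaled_le n
  refine ⟨hex, ⟨?_, liminf_le_limsup, ?_⟩, fun R hRange hNRC => ?_⟩
  · refine lt_of_lt_of_le (EReal.coe_pos.2 hc) (le_liminf_of_le (h := .of_forall fun n => ?_))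
    exact EReal.coe_le_coe_iff.2 (hlow n)
  · exact limsup_le_of_le (h := .of_forall fun n => EReal.coe_le_coe_iff.2 (hup n))
  · obtain ⟨z, hz, haz⟩ := BRW.exists_neg_jump ha_mean ha_nondeg
    -- Near right-continuity supplies the unit step which, with a negative jump, makes the tilted
    -- walk irreducible.
    have ha1 : 0 < (a 1).toReal :=
      ENNReal.toReal_pos (hNRC 1 le_rfl (by exact_mod_cast hRange.1)).ne' (a.apply_ne_top 1)
    obtain ⟨κ, hκ⟩ := hR.exists_tendsto ha_mean hz haz ha1
    rw [← hl'] at hκ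
    exact ⟨κ, hc.trans_le (ge_of_tendsto' hκ hlow), le_of_tendsto' hκ hup, hκ⟩
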